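/- Complex manifolds are Hausdorff and paracompact, of some finite (pure) complex dimension. For a complex manifold $X$, $\mathcal{O}_X$ is its sheaf of holomorphic functions, regarded as a sheaf of $\mathbb{C}$-algebras. A closed embedding $\iota\colon M\to M'$ of complex manifolds is a holomorphic immersion that is a homeomorphism onto a closed subset of $M'$. For a holomorphic map $\iota\colon M\to M'$, $\iota^{-1}\mathcal{O}_{M'}$ is the inverse image sheaf of $\mathbb{C}$-algebras on $M$, and $\iota^\#\colon\iota^{-1}\mathcal{O}_{M'}\to\mathcal{O}_M$ is the canonical morphism, $f\mapsto f\circ\iota$. Let $M$ be a complex manifold of dimension $m$. (i) Let $n$ be a natural number, let $\mathcal{A}$ be a sheaf of $\mathbb{C}$-algebras on $M$ and let $\pi\colon\mathcal{A}\to\mathcal{O}_M$ be a morphism of sheaves of $\mathbb{C}$-algebras. Suppose that each $x\in M$ has an open neighbourhood $U$ for which there is an isomorphism of sheaves of $\mathbb{C}$-algebras $e\colon\mathcal{A}|_U\to\iota_U^{-1}\mathcal{O}_{U\times\mathbb{C}^n}$, where $\iota_U\colon U\to U\times\mathbb{C}^n$ is the embedding $x\mapsto(x,0)$, such that $\iota_U^\#\circ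 e=\pi|_U$. Then there exist a complex manifold $M'$ of dimension $m+n$, a closed embedding $\iota\colon M\to M'$ and an isomorphism $e\colon\mathcal{A}\to\iota^{-1}\mathcal{O}_{M'}$ of sheaves of $\mathbb{C}$-algebras such that $\iota^\#\circ e=\pi$. (ii) Let $M_1',M_2'$ be complex manifolds, let $\iota_1\colon M\to M_1'$ and $\iota_2\colon M\to M_2'$ be closed embeddings, and let $\phi\colon\iota_1^{-1}\mathcal{O}_{M_1'}\to\iota_2^{-1}\mathcal{O}_{M_2'}$ be an isomorphism of sheaves of $\mathbb{C}$-algebras with $\iota_2^\#\circ\phi=\iota_1^\#$. Then there are open neighbourhoods $N_i$ of $\iota_i(M)$ in $M_i'$ $(i=1,2)$ and a biholomorphic map $\varphi\colon N_2\to N_1$ with $\varphi\circ\iota_2=\iota_1$ that induces $\phi$: for every $x\in M$, $\phi$ sends the germ at $\iota_1(x)$ of a holomorphic function $f$ to the germ at $\iota_2(x)$ of $f\circ\varphi$. Such a map $\varphi$ is unique as a germ: if $\varphi\colon N_2\to N_1$ and $\psi\colon P_2\to P_1$ are two such maps, then $\varphi=\psi$ on some open neighbourhood of $\iota_2(M)$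 contained in $N_2\cap P_2$. -/

import Mathlib

open CategoryTheory TopologicalSpace Opposite
open scoped Manifold ContDiff Topology

universe u v

/-- Germs of complex-valued functions along a filter form a `ℂ`-algebra, for the pointwise
operations. -/
noncomputable instance Filter.Germ.complexAlgebra {X : Type*} (l : Filter X) :
    Algebra ℂ (l.Germ ℂ) :=
  Algebra.ofModule
    (fun c f g => Filter.Germ.inductionOn₂ f g fun a b =>
      congrArg (fun h : X → ℂ => (h : l.Germ ℂ)) (smul_mul_assoc c a b))
    (fun c f g => Filter.Germ.inductionOn₂ f g fun a b =>
      congrArg (fun h : X → ℂ => (h : l.Germ ℂ)) (mul_smul_comm c a b))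

theorem Filter.Germ.complexAlgebraMap_eq {X : Type*} (l : Filter X) (c : ℂ) :
    algebraMap ℂ (l.Germ ℂ) c = ((fun _ : X => c : X → ℂ) : l.Germ ℂ) :=
  (Algebra.algebraMap_eq_smul_one (A := l.Germ ℂ) c).trans <|
    congrArg (fun h : X → ℂ => (h : l.Germ ℂ)) (funext fun _ => mul_one c)

namespace HolNbhd

/-- `ℂⁿ`. -/
abbrev Cn (n : ℕ) : Type := EuclideanSpace ℂ (Fin n)

section SheafOfSections

variable {X : Type u} [TopologicalSpace X] (T : X → Type v) [∀ x, Ring (T x)]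
  [∀ x, Algebra ℂ (T x)]

/-- A local condition on dependent functions `x ↦ T x` that is stable under the `ℂ`-algebra
operations. -/
structure LocalSubalgebra where
  /-- the sections over `U` -/
  sec : ∀ U : Opens X, Subalgebra ℂ (∀ x : U, T x)
  /-- stability under restriction -/
  res : ∀ {U V : Opens X} (h : V ≤ U) {s : ∀ x : U, T x}, s ∈ sec U →
    (fun x : V => s ⟨x, h x.2⟩) ∈ sec V
  /-- locality -/
  locality : ∀ {U : Opens X} (s : ∀ x : U, T x),
    (∀ x : U, ∃ (V : Opens X) (h : V ≤ U), x.1 ∈ V ∧ (fun y : V => s ⟨y, h y.2⟩) ∈ sec V) →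
    s ∈ sec U

variable {T}

/-- The presheaf of `ℂ`-algebras of dependent functions satisfying a local condition, with the
usual restriction maps. -/
noncomputable def LocalSubalgebra.presheaf (S : LocalSubalgebra T) :
    TopCat.Presheaf (AlgCat.{max u v} ℂ) (TopCat.of X) where
  obj U := AlgCat.of ℂ (S.sec U.unop)
  map i := AlgCat.ofHom
    { toFun := fun s => ⟨fun x => s.1 ⟨x, i.unop.le x.2⟩, S.res i.unop.le s.2⟩
      map_one' := rfl
      map_mul' := fun _ _ => rfl
      map_zero' := rfl
      map_add' := fun _ _ => rfl
      commutes' := fun _ => rfl }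
  map_id _ := rfl
  map_comp _ _ := rfl

/-- The sheaf of `ℂ`-algebras of dependent functions satisfying a local condition. -/
noncomputable def LocalSubalgebra.sheaf (S : LocalSubalgebra T) :
    TopCat.Sheaf (AlgCat.{max u v} ℂ) (TopCat.of X) :=
  ⟨S.presheaf, by
    have key := TopCat.subpresheafToTypes.isSheaf (X := TopCat.of X) (T := T)
      { pred := fun {U} s => s ∈ S.sec U
        res := fun i _ h => S.res i.le h
        locality := fun s w => S.locality s fun x => by
          obtain ⟨V, hx, i, h⟩ := w x
          exact ⟨V, i.le, hx, h⟩ }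
    have : Limits.HasLimitsOfSize.{u, u} (AlgCat.{max u v} ℂ) :=
      Limits.hasLimitsOfSizeShrink.{u, u, v, v} _
    have : Limits.PreservesLimitsOfSize.{u, u} (forget (AlgCat.{max u v} ℂ)) :=
      Limits.preservesLimitsOfSize_shrink.{u, v, u, v} _
    exact (TopCat.Presheaf.isSheaf_iff_isSheaf_comp'.{u} (X := TopCat.of X)
      (forget (AlgCat.{max u v} ℂ)) S.presheaf).2 key⟩

end SheafOfSections

section Holomorphic

variable {E : Type*} [NormedAddCommGroup E] [NormedSpace ℂ E] {H : Type*} [TopologicalSpace H]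
  (I : ModelWithCorners ℂ E H) (M : Type u) [TopologicalSpace M] [ChartedSpace H M]

variable {M} in
theorem contMDiffAt_iff_of_extension {U : Opens M} (s : U → ℂ) {F : M → ℂ}
    (hF : ∀ y : U, F y = s y) (x : U) :
    ContMDiffAt I 𝓘(ℂ, ℂ) ω s x ↔ ContMDiffAt I 𝓘(ℂ, ℂ) ω F x := by
  rw [← contMDiffAt_subtype_iff, funext hF]

/-- The structure sheaf `𝒪_M` of a complex manifold `M`: its sections over an open set `U` are the
holomorphic (that is, complex analytic) functions `U → ℂ`. -/
noncomputable def structureSheaf : TopCat.Sheaf (AlgCat.{u} ℂ) (TopCat.of M) :=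
  LocalSubalgebra.sheaf.{u, 0} (X := M) (T := fun _ => ℂ)
    { sec := fun U =>
        { carrier := {f : U → ℂ | ContMDiff I 𝓘(ℂ, ℂ) ω f}
          mul_mem' := fun hf hg => ContMDiff.mul hf hg
          add_mem' := fun hf hg => ContMDiff.add hf hg
          algebraMap_mem' := fun _ => contMDiff_const }
      res := fun h _ hs => ContMDiff.comp hs (contMDiff_inclusion h)
      locality := by
        intro U s w x
        obtain ⟨V, h, hx, hs⟩ := w x
        refine (contMDiffAt_iff_of_extension I s (F := Function.extend Subtype.val s 0)
          (fun y => Subtype.val_injective.extend_apply s 0 y) x).2 ?_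
        exact (contMDiffAt_iff_of_extension I (fun y : V => s ⟨y, h y.2⟩)
          (fun y => Subtype.val_injective.extend_apply s 0 ⟨y, h y.2⟩) ⟨x, hx⟩).1 hs.contMDiffAt }

variable {M}
variable {X : Type u} [TopologicalSpace X]

/-- For a continuous map `ι : X → M` to a complex manifold, the inverse image sheaf `ι⁻¹𝒪_M`.
The elements of the stalk of `𝒪_M` at `p` are the germs at `p` of the functions that are holomorphic
near `p`; the sections of `ι⁻¹𝒪_M` over `U` are the sections over `U` of the pulled back étalé
space, i.e. the families of germs `s x` at `ι x`, `x ∈ U`, such that each point of `U` has a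
neighbourhood in `U` on which all `s y` are germs of one function that is holomorphic on an open
neighbourhood of `ι x`. -/
noncomputable def inverseImage (ι : X → M) : TopCat.Sheaf (AlgCat.{u} ℂ) (TopCat.of X) :=
  LocalSubalgebra.sheaf.{u, u} (X := X) (T := fun x => (𝓝 (ι x)).Germ ℂ)
    { sec := fun U =>
        { carrier := {s : ∀ x : U, (𝓝 (ι x)).Germ ℂ | ∀ x : U, ∃ (W : Opens M) (f : M → ℂ),
            ι x ∈ W ∧ ContMDiffOn I 𝓘(ℂ, ℂ) ω f W ∧
            ∀ᶠ y in 𝓝 x, s y = (f : (𝓝 (ι y)).Germ ℂ)}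
          mul_mem' := by
            intro s t hs ht x
            obtain ⟨W, f, hW, hf, hsf⟩ := hs x
            obtain ⟨W', g, hW', hg, htg⟩ := ht x
            refine ⟨W ⊓ W', f * g, ⟨hW, hW'⟩,
              (hf.mono fun _ h => h.1).mul (hg.mono fun _ h => h.2), ?_⟩
            filter_upwards [hsf, htg] with y h₁ h₂
            rw [Pi.mul_apply, h₁, h₂, Filter.Germ.coe_mul]
          add_mem' := by
            intro s t hs ht x
            obtain ⟨W, f, hW, hf, hsf⟩ := hs x
            obtain ⟨W', g, hW', hg, htg⟩ := ht x
            refine ⟨W ⊓ W', f + g, ⟨hW, hW'⟩,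
              (hf.mono fun _ h => h.1).add (hg.mono fun _ h => h.2), ?_⟩
            filter_upwards [hsf, htg] with y h₁ h₂
            rw [Pi.add_apply, h₁, h₂, Filter.Germ.coe_add]
          algebraMap_mem' := fun c x => by
            refine ⟨⊤, fun _ => c, trivial, contMDiffOn_const, Filter.Eventually.of_forall ?_⟩
            intro y
            exact Filter.Germ.complexAlgebraMap_eq (𝓝 (ι y)) c }
      res := by
        intro U V h s hs x
        obtain ⟨W, f, hW, hf, hsf⟩ := hs ⟨x, h x.2⟩
        exact ⟨W, f, hW, hf, (continuous_inclusion h).continuousAt.eventually hsf⟩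
      locality := by
        intro U s w x
        obtain ⟨V, h, hx, hs⟩ := w x
        obtain ⟨W, f, hW, hf, hsf⟩ := hs ⟨x, hx⟩
        refine ⟨W, f, hW, hf, ?_⟩
        have hemb := Opens.isOpenEmbedding_of_le h
        have := hemb.map_nhds_eq ⟨x, hx⟩
        rw [show 𝓝 x = _ from this.symm]
        exact hsf }

/-- The canonical morphism `ι^♯ : ι⁻¹𝒪_{M'} ⟶ 𝒪_M` of a holomorphic map `ι : M → M'`. A section
`s`, locally given by the germs of `f`, is sent to the function `x ↦ (s x)(ι x)`, locally given by
`f ∘ ι`. -/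
noncomputable def sharp {E' : Type*} [NormedAddCommGroup E'] [NormedSpace ℂ E'] {H' : Type*}
    [TopologicalSpace H'] (J : ModelWithCorners ℂ E' H') {M' : Type u} [TopologicalSpace M']
    [ChartedSpace H' M'] (ι : M → M') (hι : ContMDiff I J ω ι) :
    inverseImage J ι ⟶ structureSheaf I M :=
  ⟨{ app := fun U => AlgCat.ofHom
      { toFun := fun s => ⟨fun x => (s.1 x).value, fun x => by
          obtain ⟨W, f, hW, hf, hsf⟩ := s.2 x
          have h₁ : ContMDiffAt I 𝓘(ℂ, ℂ) ω (fun y : U.unop => f (ι y)) x :=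
            (hf.contMDiffAt (W.isOpen.mem_nhds hW)).comp x
              (hι.comp contMDiff_subtype_val).contMDiffAt
          refine h₁.congr_of_eventuallyEq ?_
          filter_upwards [hsf] with y hy
          rw [hy]; rfl⟩
        map_one' := rfl
        map_mul' := fun s t => Subtype.ext <| funext fun x =>
          map_mul (Filter.Germ.valueRingHom (x := ι x)) (s.1 x) (t.1 x)
        map_zero' := rfl
        map_add' := fun s t => Subtype.ext <| funext fun x =>
          map_add (Filter.Germ.valueRingHom (x := ι x)) (s.1 x) (t.1 x)
        commutes' := fun c => Subtype.ext <| funext fun x =>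
          congrArg Filter.Germ.value (Filter.Germ.complexAlgebraMap_eq (𝓝 (ι x)) c) }
     naturality := fun _ _ _ => rfl }⟩

/-- The restriction `𝒜|_U` of a sheaf of `ℂ`-algebras to an open subset `U`. -/
noncomputable def restrict (U : Opens X) :
    TopCat.Sheaf (AlgCat.{u} ℂ) (TopCat.of X) ⥤ TopCat.Sheaf (AlgCat.{u} ℂ) (TopCat.of U) :=
  Topology.IsOpenEmbedding.sheafPullback (X := TopCat.of U) (Y := TopCat.of X) (AlgCat.{u} ℂ)
    (f := TopCat.ofHom ⟨Subtype.val, continuous_subtype_val⟩) U.isOpen.isOpenEmbedding_subtypeVal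

/-- The identification of `𝒪_M|_U` with the structure sheaf `𝒪_U` of the open submanifold `U`. -/
noncomputable def restrictStructureSheaf (U : Opens M) :
    (restrict U).obj (structureSheaf I M) ⟶ structureSheaf I U :=
  ⟨{ app := fun V => AlgCat.ofHom
      { toFun := fun f => ⟨fun x => f.1 ⟨x.1, ⟨x.1, x.2, rfl⟩⟩, 
          fun x => by
            have h := (contMDiffAt_iff_of_extension I f.1
              (fun y => Subtype.val_injective.extend_apply f.1 0 y)
              ⟨x.1, ⟨x.1, x.2, rfl⟩⟩).1 (f.2 _)
            exact (ContMDiffAt.comp (g := Function.extend Subtype.val f.1 0) x h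
              ((contMDiff_subtype_val (U := U)).comp
              (contMDiff_subtype_val (U := V.unop))).contMDiffAt).congr_of_eventuallyEq
                (Filter.Eventually.of_forall fun y => (Subtype.val_injective.extend_apply f.1 0
                  ⟨y.1, ⟨y.1, y.2, rfl⟩⟩).symm)⟩
        map_one' := rfl
        map_mul' := fun _ _ => rfl
        map_zero' := rfl
        map_add' := fun _ _ => rfl
        commutes' := fun _ => rfl }
     naturality := fun _ _ _ => rfl }⟩

/-- A closed embedding of complex manifolds: a holomorphic immersion that is a homeomorphism onto a
closed subset. -/
structure IsClosedHolEmbedding {E' : Type*} [NormedAddCommGroup E'] [NormedSpace ℂ E'] {H' : Type*}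
    [TopologicalSpace H'] (J : ModelWithCorners ℂ E' H') {M' : Type*} [TopologicalSpace M']
    [ChartedSpace H' M'] (ι : M → M') : Prop where
  isSmoothEmbedding : Manifold.IsSmoothEmbedding I J ω ι
  isClosed_range : IsClosed (Set.range ι)

/-- The embedding `U → U × ℂⁿ`, `x ↦ (x, 0)`. -/
def zeroSection (X : Type*) (n : ℕ) (x : X) : X × Cn n := (x, 0)

theorem contMDiff_zeroSection (n : ℕ) :
    ContMDiff I (I.prod 𝓘(ℂ, Cn n)) ω (zeroSection M n) :=
  contMDiff_id.prodMk contMDiff_const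

/-- The local condition on `π : 𝒜 ⟶ 𝒪_M`: each point has an open neighbourhood `U` with an
isomorphism `𝒜|_U ≅ ι⁻¹𝒪_{U × ℂⁿ}` that carries `π|_U` to `ι^♯`. -/
def IsLocallyNeighbourhood (n : ℕ) (A : TopCat.Sheaf (AlgCat.{u} ℂ) (TopCat.of M))
    (π : A ⟶ structureSheaf I M) : Prop :=
  ∀ x : M, ∃ U : Opens M, x ∈ U ∧
    ∃ e : (restrict U).obj A ≅ inverseImage (I.prod 𝓘(ℂ, Cn n)) (zeroSection U n),
      e.hom ≫ sharp I (I.prod 𝓘(ℂ, Cn n)) (zeroSection U n) (contMDiff_zeroSection I n) =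
        (restrict U).map π ≫ restrictStructureSheaf I U

end Holomorphic

section Biholomorphism

variable {E₁ : Type*} [NormedAddCommGroup E₁] [NormedSpace ℂ E₁] {H₁ : Type*} [TopologicalSpace H₁]
  (J₁ : ModelWithCorners ℂ E₁ H₁) {M₁ : Type u} [TopologicalSpace M₁] [ChartedSpace H₁ M₁]
  {E₂ : Type*} [NormedAddCommGroup E₂] [NormedSpace ℂ E₂] {H₂ : Type*} [TopologicalSpace H₂]
  (J₂ : ModelWithCorners ℂ E₂ H₂) {M₂ : Type u} [TopologicalSpace M₂] [ChartedSpace H₂ M₂]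
  {X : Type u} [TopologicalSpace X] (ι₁ : X → M₁) (ι₂ : X → M₂)

/-- A biholomorphic map `N₂ → N₁` between open neighbourhoods of `X` in `M₂` and in `M₁` that is the
identity on `X`. -/
structure NbhdBiholomorphism where
  /-- the neighbourhood in `M₁` -/
  N₁ : Opens M₁
  /-- the neighbourhood in `M₂` -/
  N₂ : Opens M₂
  mem₁ : ∀ x, ι₁ x ∈ N₁
  mem₂ : ∀ x, ι₂ x ∈ N₂
  /-- the biholomorphic map -/
  toDiffeomorph : Diffeomorph J₂ J₁ N₂ N₁ ω
  map_ι : ∀ x, toDiffeomorph ⟨ι₂ x, mem₂ x⟩ = ⟨ι₁ x, mem₁ x⟩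

variable {J₁ J₂ ι₁ ι₂}

/-- The morphism `φ : ι₁⁻¹𝒪_{M₁} ⟶ ι₂⁻¹𝒪_{M₂}` is the one induced by `Φ`, i.e. it is given by
pull-back of germs along `Φ`: if the germ of `f` at `ι₁ x` is the value at `x` of a section `s` and
the germ of `g` at `ι₂ x` is the value at `x` of `φ s`, then `g = f ∘ Φ` near `ι₂ x`. -/
def NbhdBiholomorphism.Induces (Φ : NbhdBiholomorphism J₁ J₂ ι₁ ι₂)
    (φ : inverseImage J₁ ι₁ ⟶ inverseImage J₂ ι₂) : Prop :=
  ∀ (U : Opens X) (s : (inverseImage J₁ ι₁).obj.obj (op U)) (x : U) (f : M₁ → ℂ) (g : M₂ → ℂ),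
    s.1 x = (f : (𝓝 (ι₁ x)).Germ ℂ) →
    (φ.hom.app (op U) s).1 x = (g : (𝓝 (ι₂ x)).Germ ℂ) →
    ∀ᶠ z : Φ.N₂ in 𝓝 ⟨ι₂ x, Φ.mem₂ x⟩, g z = f (Φ.toDiffeomorph z)

/-- Two biholomorphic maps define the same germ of maps along `X`: they agree on an open
neighbourhood of `X` in `M₂` that is contained in both domains. -/
def NbhdBiholomorphism.SameGerm (Φ Ψ : NbhdBiholomorphism J₁ J₂ ι₁ ι₂) : Prop :=
  ∃ W : Opens M₂, (∀ x, ι₂ x ∈ W) ∧ ∃ (hΦ : W ≤ Φ.N₂) (hΨ : W ≤ Ψ.N₂),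
    ∀ z : W, (Φ.toDiffeomorph ⟨z, hΦ z.2⟩ : M₁) = Ψ.toDiffeomorph ⟨z, hΨ z.2⟩

end Biholomorphism

end HolNbhd

/-! The local core is that a homomorphism of `ℂ`-algebras between rings of convergent power series
is composition with a holomorphic map germ, whose components are the images of the coordinates.
Hadamard's lemma writes f - f(a) as a combination of the coordinate differences; iterating, the
homomorphism and the composition agree to every order, and an analytic function that vanishes to
infinite order is zero (`IsGermHom.eventuallyEq_comp`). A `GermModel` describes a sheaf of algebras
by germs of holomorphic functions. Two models with the same values along M are therefore related by
a holomorphic map germ at each point (`exists_isTransition`). That germ is unique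
(`IsTransition.eventuallyEq`), and a representative also works at neighbouring points.

For (ii), uniqueness makes the transition germs compatible, and compatible germs along a closed
subset of a paracompact Hausdorff space come from one map (`exists_eventuallyEq_of_cover`). This is
done in both directions. By uniqueness again, both composites are the identity near M, so the maps
are mutually inverse on suitable neighbourhoods.

For (i), the transition germs F_ij of the local models satisfy the cocycle condition only near M,
and a direct gluing of shrunken pieces would have to be made Hausdorff. Instead all models are
mapped to one metrizable space. Take a partition of unity λ_j subordinate to the charts, pulled back
to the models by projection, and send p in the i-th model to the family (λ_j(F_ji p), λ_j(F_ji p)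
F_ji p)_j. The cocycle condition makes these maps agree near M, and the quotient of the two entries
recovers the j-th coordinates wherever the weight is nonzero. The manifold M' consists of the points
of this space at which all available coordinates are inverted by the parametrizations and are
holomorphically related (`AmbientAtlas.carrier`). Local finiteness makes the coordinates charts of
M', and M' is Hausdorff and paracompact because it is a subspace of a metrizable space. The models,
transported to M' by the charts, agree because the changes of coordinates are the transition maps;
so they form one model, which is an isomorphism of sheaves. -/

/-! ### Analytic functions: Hadamard's lemma and vanishing to infinite order -/

section Analytic

variable {E : Type*} [NormedAddCommGroup E] [NormedSpace ℂ E]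

/-- Hadamard's lemma for analytic functions. -/
theorem AnalyticAt.exists_eq_add_apply_sub {f : E → ℂ} {a : E} (hf : AnalyticAt ℂ f a) :
    ∃ g : E → E →L[ℂ] ℂ, AnalyticAt ℂ g a ∧ ∀ᶠ z in 𝓝 a, f z = f a + g z (z - a) := by
  obtain ⟨p, r, hp⟩ := hf
  -- The quotient g is the sum of the shifted series: each homogeneous term has one argument split
  -- off, and unshifting with constant term f a restores p.
  have hrad : 0 < p.shift.radius := by
    rw [FormalMultilinearSeries.radius_shift]
    exact hp.r_pos.trans_le hp.r_le
  have hg := p.shift.hasFPowerSeriesOnBall hrad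
  have hg' := hg.comp_sub a
  rw [zero_add] at hg'
  have hu := hg'.unshift (z := f a)
  have hpe : p.shift.unshift (f a) = p := by
    funext n
    cases n with
    | zero =>
      ext v
      simp only [FormalMultilinearSeries.unshift]
      rw [hp.coeff_zero v]
      rfl
    | succ n =>
      simp only [FormalMultilinearSeries.unshift, FormalMultilinearSeries.shift]
      exact ContinuousMultilinearMap.uncurry_curryRight _
  rw [hpe] at hu
  have hu' := hu.mono (r' := min r p.shift.radius) (lt_min hp.r_pos hrad) (min_le_right _ _)
  have hp' := hp.mono (r' := min r p.shift.radius) (lt_min hp.r_pos hrad) (min_le_left _ _)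
  refine ⟨fun z => p.shift.sum (z - a), hg'.analyticAt, ?_⟩
  exact Filter.eventually_of_mem (Metric.eball_mem_nhds _ (lt_min hp.r_pos hrad))
    (hp'.unique hu')

/-- An analytic function that vanishes to infinite order at a point vanishes near that point. -/
theorem AnalyticAt.eventuallyEq_zero_of_isBigO_pow {f : E → ℂ} {a : E} (hf : AnalyticAt ℂ f a)
    (h : ∀ N : ℕ, f =O[𝓝 a] fun z => ‖z - a‖ ^ N) : f =ᶠ[𝓝 a] 0 := by
  obtain ⟨p, hp⟩ := hf
  have htend : Filter.Tendsto (fun y => a + y) (𝓝 0) (𝓝 a) := by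
    have : ContinuousAt (fun y => a + y) (0 : E) := by fun_prop
    simpa [ContinuousAt] using this
  -- Once the lower terms vanish, the n-th term equals f minus a remainder, both O(‖y‖^(n+1)); a
  -- homogeneous polynomial of degree n of that size is zero.
  have hz : ∀ n : ℕ, ∀ y : E, p n (fun _ => y) = 0 := by
    intro n
    induction n using Nat.strong_induction_on with
    | _ n ih =>
      refine Asymptotics.IsBigO.continuousMultilinearMap_apply_eq_zero ?_
      have h₁ := hp.isBigO_sub_partialSum_pow (n + 1)
      have h₂ := (h (n + 1)).comp_tendsto htend
      have h₃ : (fun y : E => f (a + y)) =O[𝓝 0] fun y : E => ‖y‖ ^ (n + 1) := by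
        refine h₂.congr (fun _ => rfl) (fun y => ?_)
        simp
      refine (h₃.sub h₁).congr_left fun y => ?_
      have : p.partialSum (n + 1) y = p n fun _ => y := by
        rw [FormalMultilinearSeries.partialSum, Finset.sum_range_succ,
          Finset.sum_eq_zero fun k hk => ih k (Finset.mem_range.1 hk) y, zero_add]
      rw [this]
      ring
  obtain ⟨r, hr⟩ := hp
  filter_upwards [Metric.eball_mem_nhds a hr.r_pos] with z hz'
  have hs := hr.hasSum_sub hz'
  simp only [hz] at hs
  exact hs.unique hasSum_zero

end Analytic

/-! ### Holomorphic functions in the charts of a manifold -/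

namespace HolNbhd

section Coordinates

variable {d : ℕ} {N : Type*} [TopologicalSpace N] [ChartedSpace (Cn d) N]

/-- The `k`-th coordinate function of the preferred chart at `a`. -/
noncomputable def coordAt (d : ℕ) {N : Type*} [TopologicalSpace N] [ChartedSpace (Cn d) N] (a : N)
    (k : Fin d) (p : N) : ℂ := extChartAt 𝓘(ℂ, Cn d) a p k

theorem contMDiffAt_coordAt [IsManifold 𝓘(ℂ, Cn d) ω N] {a p : N}
    (hp : p ∈ (chartAt (Cn d) a).source) (k : Fin d) :
    ContMDiffAt 𝓘(ℂ, Cn d) 𝓘(ℂ, ℂ) ω (coordAt d a k) p := by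
  have h₁ : ContMDiffAt 𝓘(ℂ, Cn d) 𝓘(ℂ, Cn d) ω (extChartAt 𝓘(ℂ, Cn d) a) p :=
    contMDiffAt_extChartAt' hp
  have h₂ : ContMDiff 𝓘(ℂ, Cn d) 𝓘(ℂ, ℂ) ω (fun y : Cn d => y k) :=
    (EuclideanSpace.proj (𝕜 := ℂ) k : Cn d →L[ℂ] ℂ).contMDiff
  exact h₂.contMDiffAt.comp p h₁

theorem eventuallyEq_comp_extChartAt {f : N → ℂ} {c a : N} (ha : a ∈ (chartAt (Cn d) c).source) :
    ∀ᶠ p in 𝓝 a, f p = (f ∘ (extChartAt 𝓘(ℂ, Cn d) c).symm) (extChartAt 𝓘(ℂ, Cn d) c p) := by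
  filter_upwards [extChartAt_source_mem_nhds' (I := 𝓘(ℂ, Cn d))
    (by rwa [extChartAt_source] : a ∈ (extChartAt 𝓘(ℂ, Cn d) c).source)] with p hp
  rw [Function.comp_apply, (extChartAt 𝓘(ℂ, Cn d) c).left_inv hp]

variable [IsManifold 𝓘(ℂ, Cn d) ω N]

theorem analyticAt_comp_extChartAt_symm {f : N → ℂ} {c a : N} (ha : a ∈ (chartAt (Cn d) c).source)
    (hf : ContMDiffAt 𝓘(ℂ, Cn d) 𝓘(ℂ, ℂ) ω f a) :
    AnalyticAt ℂ (f ∘ (extChartAt 𝓘(ℂ, Cn d) c).symm) (extChartAt 𝓘(ℂ, Cn d) c a) := by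
  have ha' : a ∈ (extChartAt 𝓘(ℂ, Cn d) c).source := by rwa [extChartAt_source]
  have h₁ : ContMDiffAt 𝓘(ℂ, Cn d) 𝓘(ℂ, Cn d) ω (extChartAt 𝓘(ℂ, Cn d) c).symm
      (extChartAt 𝓘(ℂ, Cn d) c a) :=
    (contMDiffOn_extChartAt_symm c).contMDiffAt (extChartAt_target_mem_nhds' (by
      exact (extChartAt 𝓘(ℂ, Cn d) c).map_source ha'))
  rw [← (extChartAt 𝓘(ℂ, Cn d) c).left_inv ha'] at hf
  exact analyticWithinAt_univ.1
    (contDiffWithinAt_omega_iff_analyticWithinAt.1 (hf.comp _ h₁).contDiffAt.contDiffWithinAt)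

theorem contMDiffAt_comp_extChartAt {F : Type*}
    [NormedAddCommGroup F] [NormedSpace ℂ F] [CompleteSpace F] {g : Cn d → F}
    {c a : N} (ha : a ∈ (chartAt (Cn d) c).source)
    (hg : AnalyticAt ℂ g (extChartAt 𝓘(ℂ, Cn d) c a)) :
    ContMDiffAt 𝓘(ℂ, Cn d) 𝓘(ℂ, F) ω (g ∘ extChartAt 𝓘(ℂ, Cn d) c) a :=
  (hg.contDiffAt (n := ω)).contMDiffAt.comp a (contMDiffAt_extChartAt' ha)

/-- Hadamard's lemma in coordinates. The chart is centred at c and not at the base point a, so that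
one set of coordinates serves at all points near c. -/
theorem exists_eq_add_sum_coordAt {f : N → ℂ} {c a : N} (ha : a ∈ (chartAt (Cn d) c).source)
    (hf : ContMDiffAt 𝓘(ℂ, Cn d) 𝓘(ℂ, ℂ) ω f a) :
    ∃ h : Fin d → N → ℂ, (∀ k, ContMDiffAt 𝓘(ℂ, Cn d) 𝓘(ℂ, ℂ) ω (h k) a) ∧
      ∀ᶠ p in 𝓝 a, f p = f a + ∑ k, (coordAt d c k p - coordAt d c k a) * h k p := by
  obtain ⟨g, hg, hfg⟩ := (analyticAt_comp_extChartAt_symm ha hf).exists_eq_add_apply_sub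
  refine ⟨fun k => (fun z => g z (EuclideanSpace.single k 1)) ∘ extChartAt 𝓘(ℂ, Cn d) c,
    fun k => contMDiffAt_comp_extChartAt ha
      ((ContinuousLinearMap.apply ℂ ℂ (EuclideanSpace.single k (1 : ℂ))).analyticAt _ |>.comp hg),
    ?_⟩
  have ha' : a ∈ (extChartAt 𝓘(ℂ, Cn d) c).source := by rwa [extChartAt_source]
  filter_upwards [eventuallyEq_comp_extChartAt (f := f) ha,
    (continuousAt_extChartAt' (I := 𝓘(ℂ, Cn d)) ha').eventually hfg] with p hp hp'
  rw [hp, hp', Function.comp_apply, (extChartAt 𝓘(ℂ, Cn d) c).left_inv ha']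
  congr 1
  set y := extChartAt 𝓘(ℂ, Cn d) c p - extChartAt 𝓘(ℂ, Cn d) c a with hy
  have hsum : y = ∑ k, y k • EuclideanSpace.single k (1 : ℂ) := by
    ext j
    simp [Pi.single_apply]
  conv_lhs => rw [hsum, map_sum]
  simp [hy, coordAt]

/-- A function measuring the distance to `a` in the preferred chart at `a`. -/
noncomputable def chartDist (d : ℕ) {N : Type*} [TopologicalSpace N] [ChartedSpace (Cn d) N]
    (a p : N) : ℝ :=
  ‖extChartAt 𝓘(ℂ, Cn d) a p - extChartAt 𝓘(ℂ, Cn d) a a‖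

theorem isBigO_sub_chartDist {f : N → ℂ} {a : N} (hf : ContMDiffAt 𝓘(ℂ, Cn d) 𝓘(ℂ, ℂ) ω f a) :
    (fun p => f p - f a) =O[𝓝 a] chartDist d a := by
  have h := (analyticAt_comp_extChartAt_symm (mem_chart_source (Cn d) a)
      hf).differentiableAt.isBigO_sub
  have h' := (h.comp_tendsto (continuousAt_extChartAt (I := 𝓘(ℂ, Cn d)) a)).norm_right
  refine h'.congr' ?_ (Filter.EventuallyEq.refl _ _)
  filter_upwards [eventuallyEq_comp_extChartAt (f := f) (mem_chart_source (Cn d) a)] with p hp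
  simp [hp]

theorem eventuallyEq_zero_of_isBigO_chartDist {f : N → ℂ} {a : N}
    (hf : ContMDiffAt 𝓘(ℂ, Cn d) 𝓘(ℂ, ℂ) ω f a)
    (h : ∀ n : ℕ, f =O[𝓝 a] fun p => chartDist d a p ^ n) : f =ᶠ[𝓝 a] 0 := by
  have h₀ := (analyticAt_comp_extChartAt_symm (mem_chart_source (Cn d) a)
      hf).eventuallyEq_zero_of_isBigO_pow fun n => by
    have ht : Filter.Tendsto (extChartAt 𝓘(ℂ, Cn d) a).symm (𝓝 (extChartAt 𝓘(ℂ, Cn d) a a)) (𝓝 a) :=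
        by
      have := continuousAt_extChartAt_symm (I := 𝓘(ℂ, Cn d)) a
      simpa [ContinuousAt, (extChartAt 𝓘(ℂ, Cn d) a).left_inv (mem_extChartAt_source a)] using this
    refine ((h n).comp_tendsto ht).congr' (Filter.EventuallyEq.refl _ _) ?_
    filter_upwards [extChartAt_target_mem_nhds (I := 𝓘(ℂ, Cn d)) a] with z hz
    rw [Function.comp_apply, chartDist, (extChartAt 𝓘(ℂ, Cn d) a).right_inv hz]
  filter_upwards [eventuallyEq_comp_extChartAt (f := f) (mem_chart_source (Cn d) a),
    (continuousAt_extChartAt (I := 𝓘(ℂ, Cn d)) a).eventually h₀] with p hp hp'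
  rw [hp, hp']
  rfl

end Coordinates

/-! ### Homomorphisms of algebras of holomorphic germs -/

section AlgebraicRelation

variable {d₁ d₂ : ℕ} {N₁ N₂ : Type*} [TopologicalSpace N₁] [ChartedSpace (Cn d₁) N₁]
  [TopologicalSpace N₂] [ChartedSpace (Cn d₂) N₂]

/-- A relation between functions near `a` and functions near `b` that is the graph of a
homomorphism of `ℂ`-algebras from the ring of holomorphic germs at `a` to that at `b`. -/
structure IsGermHom (a : N₁) (b : N₂) (R : (N₁ → ℂ) → (N₂ → ℂ) → Prop) : Prop where
  contMDiffAt : ∀ {f g}, R f g → ContMDiffAt 𝓘(ℂ, Cn d₂) 𝓘(ℂ, ℂ) ω g b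
  exists_rel : ∀ {f}, ContMDiffAt 𝓘(ℂ, Cn d₁) 𝓘(ℂ, ℂ) ω f a → ∃ g, R f g
  contMDiffAt_left : ∀ {f g}, R f g → ContMDiffAt 𝓘(ℂ, Cn d₁) 𝓘(ℂ, ℂ) ω f a
  unique : ∀ {f f' g g'}, R f g → R f' g' → f =ᶠ[𝓝 a] f' → g =ᶠ[𝓝 b] g'
  const : ∀ c : ℂ, R (fun _ => c) (fun _ => c)
  add : ∀ {f f' g g'}, R f g → R f' g' → R (f + f') (g + g')
  mul : ∀ {f f' g g'}, R f g → R f' g' → R (f * f') (g * g')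

theorem IsGermHom.sum {a : N₁} {b : N₂} {R : (N₁ → ℂ) → (N₂ → ℂ) → Prop}
    (hR : IsGermHom (d₁ := d₁) (d₂ := d₂) a b R) {ι : Type*} (s : Finset ι) {f : ι → N₁ → ℂ}
    {g : ι → N₂ → ℂ} (h : ∀ k ∈ s, R (f k) (g k)) : R (∑ k ∈ s, f k) (∑ k ∈ s, g k) := by
  classical
  induction s using Finset.induction_on with
  | empty => exact hR.const 0
  | insert k s hk ih =>
    rw [Finset.sum_insert hk, Finset.sum_insert hk]
    exact hR.add (h k (Finset.mem_insert_self _ _))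
      (ih fun j hj => h j (Finset.mem_insert_of_mem hj))

variable [IsManifold 𝓘(ℂ, Cn d₁) ω N₁] [IsManifold 𝓘(ℂ, Cn d₂) ω N₂]

/-- A homomorphism of algebras of holomorphic germs is composition with any holomorphic map germ
that it is composition with on the coordinate functions. -/
theorem IsGermHom.eventuallyEq_comp {a : N₁} {b : N₂} {R : (N₁ → ℂ) → (N₂ → ℂ) → Prop}
    (hR : IsGermHom (d₁ := d₁) (d₂ := d₂) a b R) {F : N₂ → N₁} (hFb : F b = a)
    {c : N₁} (hc : a ∈ (chartAt (Cn d₁) c).source)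
    (hF : ContMDiffAt 𝓘(ℂ, Cn d₂) 𝓘(ℂ, Cn d₁) ω F b)
    (hcoord : ∀ k, R (coordAt d₁ c k) (coordAt d₁ c k ∘ F)) {f : N₁ → ℂ} {g : N₂ → ℂ} (h : R f g) :
    g =ᶠ[𝓝 b] f ∘ F := by
  subst hFb
  have hcomp : ∀ {f : N₁ → ℂ}, ContMDiffAt 𝓘(ℂ, Cn d₁) 𝓘(ℂ, ℂ) ω f (F b) →
      ContMDiffAt 𝓘(ℂ, Cn d₂) 𝓘(ℂ, ℂ) ω (f ∘ F) b := fun hf => hf.comp b hF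
  -- Induction on the order of agreement. Expanding f by Hadamard, the homomorphism sends each
  -- coordinate to its composition with F and each quotient q k to some g' k. The error is a sum of
  -- terms (coordinate difference) * (g' k - q k ∘ F): the first factor vanishes at b, the second
  -- has order n.
  have key : ∀ n : ℕ, ∀ f g, R f g →
      (fun p => g p - f (F p)) =O[𝓝 b] fun p => chartDist d₂ b p ^ n := by
    intro n
    induction n with
    | zero =>
      intro f g h
      simp only [pow_zero]
      exact ((hR.contMDiffAt h).continuousAt.sub
        (hcomp (hR.contMDiffAt_left h)).continuousAt).isBigO_one ℝ
    | succ n ih =>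
      intro f g h
      obtain ⟨q, hq, hfq⟩ := exists_eq_add_sum_coordAt hc (hR.contMDiffAt_left h)
      choose g' hg' using fun k => hR.exists_rel (hq k)
      have h₁ : R ((fun _ => f (F b)) + ∑ k, (coordAt d₁ c k + fun _ => - coordAt d₁ c k (F b)) * q
          k)
          ((fun _ => f (F b)) +
            ∑ k, (coordAt d₁ c k ∘ F + fun _ => - coordAt d₁ c k (F b)) * g' k) :=
        hR.add (hR.const _) (hR.sum _ fun k _ => hR.mul (hR.add (hcoord k) (hR.const _)) (hg' k))
      have h₂ := hR.unique h h₁ (by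
        filter_upwards [hfq] with p hp
        simpa [Finset.sum_apply, sub_eq_add_neg] using hp)
      have h₃ : (fun p => ∑ k, (coordAt d₁ c k (F p) - coordAt d₁ c k (F b)) *
          (g' k p - q k (F p))) =O[𝓝 b] fun p => chartDist d₂ b p ^ (n + 1) := by
        simp only [pow_succ']
        refine Asymptotics.IsBigO.fun_sum fun k _ => ?_
        exact (isBigO_sub_chartDist (hcomp (contMDiffAt_coordAt hc k))).mul
          (ih _ _ (hg' k))
      refine h₃.congr' ?_ (Filter.EventuallyEq.refl _ _)
      filter_upwards [h₂, hF.continuousAt.eventually hfq] with p hp hp'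
      rw [hp, hp']
      simp only [Pi.add_apply, Finset.sum_apply, Pi.mul_apply, Function.comp_apply]
      rw [add_sub_add_left_eq_sub, ← Finset.sum_sub_distrib]
      exact Finset.sum_congr rfl fun k _ => by ring
  have := eventuallyEq_zero_of_isBigO_chartDist
    ((hR.contMDiffAt h).sub (hcomp (hR.contMDiffAt_left h))) fun n => key n f g h
  filter_upwards [this] with p hp
  exact sub_eq_zero.1 hp

end AlgebraicRelation

end HolNbhd

/-! ### Gluing germs of functions along a subspace -/

section GlueGerms

/-- Functions on the members of an open cover whose germs agree along a set `Z` can be glued to a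
global function, after shrinking. -/
theorem exists_eventuallyEq_of_cover {T α ι : Type*} [TopologicalSpace T] [T2Space T]
    [ParacompactSpace T] (Z : Set T) (B : ι → Set T) (hB : ∀ i, IsOpen (B i))
    (hcov : ⋃ i, B i = Set.univ) (f : ι → T → α)
    (h : ∀ i j, ∀ z ∈ Z, z ∈ B i → z ∈ B j → f i =ᶠ[𝓝 z] f j) :
    ∃ g : T → α, ∀ i, ∀ z ∈ Z, z ∈ B i → g =ᶠ[𝓝 z] f i := by
  obtain ⟨W, hWo, hWc, hWf, hWB⟩ := precise_refinement B hB hcov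
  obtain ⟨C, hCcov, hCcl, hCW⟩ := exists_iUnion_eq_closed_subset hWo (fun x => hWf.point_finite x)
      hWc
  have hmem : ∀ t, ∃ i, t ∈ C i := fun t => Set.mem_iUnion.1 (hCcov ▸ Set.mem_univ t)
  choose k hk using hmem
  have hCf : LocallyFinite C := hWf.subset hCW
  -- At t any index k t with t in the closed set C (k t) is allowed. Near z ∈ Z only the finitely
  -- many indices whose closed set contains z can occur, and their functions agree there; no
  -- continuity of the choice is needed.
  refine ⟨fun t => f (k t) t, fun i z hz hzi => ?_⟩
  have hfin := hCf.point_finite z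
  have h₁ : ∀ᶠ t in 𝓝 z, ∀ j, t ∈ C j → z ∈ C j :=
    hCf.eventually_subset hCcl z
  have h₂ : ∀ᶠ t in 𝓝 z, ∀ j ∈ {j | z ∈ C j}, f j t = f i t :=
    (Filter.eventually_all_finite hfin).2 fun j hj => h j i z hz (hWB j (hCW j hj)) hzi
  filter_upwards [h₁, h₂] with t ht₁ ht₂
  exact ht₂ _ (ht₁ _ (hk t))

variable {X T α : Type*} [TopologicalSpace X] [TopologicalSpace T] {ι : X → T}

theorem Topology.IsInducing.exists_isOpen_of_eventually (hι : IsInducing ι) {p : X → X → Prop}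
    (h : ∀ x, ∀ᶠ x' in 𝓝 x, p x x') (x : X) :
    ∃ B : Set T, IsOpen B ∧ ι x ∈ B ∧ ∀ x', ι x' ∈ B → p x x' := by
  obtain ⟨B, hB, hBp⟩ := (hι.nhds_eq_comap x ▸ h x :)
  obtain ⟨O, hOB, hO, hxO⟩ := mem_nhds_iff.1 hB
  exact ⟨O, hO, hxO, fun x' hx' => hBp (hOB hx')⟩

/-- A compatible family of germs of functions along a closed subspace is induced by one
function. -/
theorem Topology.IsInducing.exists_eventuallyEq_of_isClosed [T2Space T] [ParacompactSpace T]
    [Nonempty α] (hι : IsInducing ι) (hZ : IsClosed (Set.range ι)) (f : X → T → α)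
    (h : ∀ x, ∀ᶠ x' in 𝓝 x, f x' =ᶠ[𝓝 (ι x')] f x) :
    ∃ g : T → α, ∀ x, g =ᶠ[𝓝 (ι x)] f x := by
  obtain ⟨a⟩ := ‹Nonempty α›
  choose B hBo hxB hB using hι.exists_isOpen_of_eventually h
  obtain ⟨g, hg⟩ := exists_eventuallyEq_of_cover (Set.range ι)
    -- The index `none` stands for the complement of the closed image; it never meets Z, so a
    -- constant function will do there.
    (fun i : Option X => i.elim (Set.range ι)ᶜ B)
    (by rintro (_ | i); exacts [hZ.isOpen_compl, hBo i])
    (Set.eq_univ_of_forall fun t => Set.mem_iUnion.2 <| by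
      by_cases ht : t ∈ Set.range ι
      · obtain ⟨x, rfl⟩ := ht
        exact ⟨some x, hxB _⟩
      · exact ⟨none, ht⟩)
    (fun i => i.elim (fun _ => a) f) (by
      rintro (_ | i) (_ | j) _ ⟨z, rfl⟩ hzi hzj
      · exact (hzi ⟨z, rfl⟩).elim
      · exact (hzi ⟨z, rfl⟩).elim
      · exact (hzj ⟨z, rfl⟩).elim
      · exact (hB i z hzi).symm.trans (hB j z hzj))
  exact ⟨g, fun x => hg (some x) (ι x) ⟨x, rfl⟩ (hxB _)⟩

/-- A compatible family of germs of functions along a subspace of a metrizable space is induced by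
one function. -/
theorem Topology.IsInducing.exists_eventuallyEq_of_metrizable [MetrizableSpace T]
    [Nonempty α] (hι : IsInducing ι) (f : X → T → α)
    (h : ∀ x, ∀ᶠ x' in 𝓝 x, f x' =ᶠ[𝓝 (ι x')] f x) :
    ∃ g : T → α, ∀ x, g =ᶠ[𝓝 (ι x)] f x := by
  classical
  let _ := metrizableSpaceMetric T
  obtain ⟨a⟩ := ‹Nonempty α›
  choose B hBo hxB hB using hι.exists_isOpen_of_eventually h
  -- Without a closed image the gluing takes place on this open neighbourhood of the image. It is
  -- paracompact because metrizability passes to subspaces.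
  let T' : Set T := ⋃ x, B x
  have hT' : IsOpen T' := isOpen_iUnion hBo
  obtain ⟨g, hg⟩ := exists_eventuallyEq_of_cover (T := T') (Subtype.val ⁻¹' Set.range ι)
    (fun x => Subtype.val ⁻¹' B x) (fun x => (hBo x).preimage continuous_subtype_val)
    (Set.eq_univ_of_forall fun t => by
      obtain ⟨z, hz⟩ := Set.mem_iUnion.1 t.2
      exact Set.mem_iUnion.2 ⟨z, hz⟩)
    (fun x t => f x t) (by
      rintro i j ⟨_, hz⟩ ⟨z, rfl⟩ hzi hzj
      exact (continuous_subtype_val.continuousAt (x := (⟨ι z, hz⟩ : T'))).eventually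
        ((hB i z hzi).symm.trans (hB j z hzj)))
  refine ⟨fun t => if ht : t ∈ T' then g ⟨t, ht⟩ else a, fun x => ?_⟩
  have hxT : ι x ∈ T' := Set.mem_iUnion.2 ⟨x, hxB _⟩
  have h₁ := hg x ⟨ι x, hxT⟩ ⟨x, rfl⟩ (hxB _)
  have h₂ : ∀ᶠ t in Filter.map Subtype.val (𝓝 (⟨ι x, hxT⟩ : T')),
      (if ht : t ∈ T' then g ⟨t, ht⟩ else a) = f x t :=
    Filter.eventually_map.2 (h₁.mono fun t ht => by rw [dif_pos t.2]; exact ht)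
  rwa [hT'.isOpenEmbedding_subtypeVal.map_nhds_eq] at h₂

end GlueGerms

/-! ### Germ models of a sheaf and the transition germs between them -/

namespace HolNbhd

theorem eventually_subtype_iff {M : Type*} [TopologicalSpace M] {V : Opens M} {p : M → Prop}
    (x : V) : (∀ᶠ y in 𝓝 x, p y.1) ↔ ∀ᶠ y in 𝓝 x.1, p y := by
  rw [← V.isOpen.isOpenEmbedding_subtypeVal.map_nhds_eq x, Filter.eventually_map]
  rfl

section GermModel

variable {M : Type u} [TopologicalSpace M]

/-- A model of the sheaf of algebras `A` over the open set `U`: an isomorphism, written in terms of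
germs, between `A` and the inverse image of the sheaf of holomorphic functions on `N` under
a map `ι : M → N` that is continuous on `U`. -/
structure GermModel (A : TopCat.Sheaf (AlgCat.{u} ℂ) (TopCat.of M)) (U : Opens M) {E : Type*}
    [NormedAddCommGroup E] [NormedSpace ℂ E] {H : Type*} [TopologicalSpace H]
    (J : ModelWithCorners ℂ E H) {N : Type v} [TopologicalSpace N] [ChartedSpace H N] (ι : M → N)
        where
  /-- the germ of a section at a point -/
  ev : ∀ V : Opens M, V ≤ U → A.obj.obj (op V) →ₐ[ℂ] (∀ x : V, (𝓝 (ι x)).Germ ℂ)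
  continuousAt : ∀ x ∈ U, ContinuousAt ι x
  ev_res : ∀ {V W : Opens M} (hV : V ≤ U) (h : W ≤ V) (s : A.obj.obj (op V)) (x : W),
    ev W (h.trans hV) (A.obj.map (homOfLE h).op s) x = ev V hV s ⟨x, h x.2⟩
  exists_rep : ∀ (V : Opens M) (hV : V ≤ U) (s : A.obj.obj (op V)) (x : V), ∃ f : N → ℂ,
    ContMDiffAt J 𝓘(ℂ, ℂ) ω f (ι x) ∧ ∀ᶠ y in 𝓝 x, ev V hV s y = f
  exists_section : ∀ x ∈ U, ∀ f : N → ℂ, ContMDiffAt J 𝓘(ℂ, ℂ) ω f (ι x) →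
    ∃ (V : Opens M) (hV : V ≤ U) (s : A.obj.obj (op V)), x ∈ V ∧ ∀ y : V, ev V hV s y = f
  eq_of_ev_eq : ∀ (V : Opens M) (hV : V ≤ U) (s t : A.obj.obj (op V)) (x : V),
    ev V hV s x = ev V hV t x → ∃ (W : Opens M) (h : W ≤ V), x.1 ∈ W ∧
      A.obj.map (homOfLE h).op s = A.obj.map (homOfLE h).op t

namespace GermModel

variable {A : TopCat.Sheaf (AlgCat.{u} ℂ) (TopCat.of M)} {U₁ U₂ U₃ : Opens M} {d₁ d₂ d₃ : ℕ}
  {N₁ N₂ N₃ : Type*} [TopologicalSpace N₁] [ChartedSpace (Cn d₁) N₁] [TopologicalSpace N₂]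
  [ChartedSpace (Cn d₂) N₂] [TopologicalSpace N₃] [ChartedSpace (Cn d₃) N₃]
  {ι₁ : M → N₁} {ι₂ : M → N₂} {ι₃ : M → N₃}

/-- The germ of `f` in the first model and the germ of `g` in the second one, both at `x`, represent
the same germ of a section. -/
def SendsGerm (m₁ : GermModel A U₁ 𝓘(ℂ, Cn d₁) ι₁) (m₂ : GermModel A U₂ 𝓘(ℂ, Cn d₂) ι₂) (x : M)
    (f : N₁ → ℂ)
    (g : N₂ → ℂ) : Prop :=
  ∃ (V : Opens M) (h₁ : V ≤ U₁) (h₂ : V ≤ U₂) (hx : x ∈ V) (s : A.obj.obj (op V)),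
    m₁.ev V h₁ s ⟨x, hx⟩ = f ∧ m₂.ev V h₂ s ⟨x, hx⟩ = g

/-- Both models give the same values to sections. -/
def SameValues (m₁ : GermModel A U₁ 𝓘(ℂ, Cn d₁) ι₁) (m₂ : GermModel A U₂ 𝓘(ℂ, Cn d₂) ι₂) : Prop :=
  ∀ (V : Opens M) (h₁ : V ≤ U₁) (h₂ : V ≤ U₂) (s : A.obj.obj (op V)) (x : V),
    (m₁.ev V h₁ s x).value = (m₂.ev V h₂ s x).value

variable {m₁ : GermModel A U₁ 𝓘(ℂ, Cn d₁) ι₁} {m₂ : GermModel A U₂ 𝓘(ℂ, Cn d₂) ι₂}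
    {m₃ : GermModel A U₃ 𝓘(ℂ, Cn d₃) ι₃} {x : M}

theorem contMDiffAt_of_ev_eq (m : GermModel A U₁ 𝓘(ℂ, Cn d₁) ι₁) {V : Opens M} {hV : V ≤ U₁}
    {s : A.obj.obj (op V)} {x : V} {f : N₁ → ℂ} (h : m.ev V hV s x = f) :
    ContMDiffAt 𝓘(ℂ, Cn d₁) 𝓘(ℂ, ℂ) ω f (ι₁ x) := by
  obtain ⟨f', hf', hev⟩ := m.exists_rep V hV s x
  exact hf'.congr_of_eventuallyEq (Filter.Germ.coe_eq.1 (h.symm.trans hev.self_of_nhds))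

theorem SendsGerm.value_eq {f : N₁ → ℂ} {g : N₂ → ℂ} (h : SendsGerm m₁ m₂ x f g)
    (hv : SameValues m₁ m₂) : f (ι₁ x) = g (ι₂ x) := by
  obtain ⟨V, h₁, h₂, hx, s, hf, hg⟩ := h
  have := hv V h₁ h₂ s ⟨x, hx⟩
  rwa [hf, hg] at this

theorem SendsGerm.congr {f f' : N₁ → ℂ} {g g' : N₂ → ℂ} (h : SendsGerm m₁ m₂ x f g)
    (hf : f =ᶠ[𝓝 (ι₁ x)] f') (hg : g =ᶠ[𝓝 (ι₂ x)] g') : SendsGerm m₁ m₂ x f' g' := by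
  obtain ⟨V, h₁, h₂, hx, s, h, h'⟩ := h
  exact ⟨V, h₁, h₂, hx, s, h.trans (Filter.Germ.coe_eq.2 hf), h'.trans (Filter.Germ.coe_eq.2 hg)⟩

theorem SendsGerm.exists_common {f f' : N₁ → ℂ} {g g' : N₂ → ℂ} (h : SendsGerm m₁ m₂ x f g)
    (h' : SendsGerm m₁ m₂ x f' g') :
    ∃ (V : Opens M) (h₁ : V ≤ U₁) (h₂ : V ≤ U₂) (hx : x ∈ V) (s s' : A.obj.obj (op V)),
      (m₁.ev V h₁ s ⟨x, hx⟩ = f ∧ m₂.ev V h₂ s ⟨x, hx⟩ = g) ∧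
      m₁.ev V h₁ s' ⟨x, hx⟩ = f' ∧ m₂.ev V h₂ s' ⟨x, hx⟩ = g' := by
  obtain ⟨V, h₁, h₂, hx, s, hf, hg⟩ := h
  obtain ⟨V', h₁', h₂', hx', s', hf', hg'⟩ := h'
  refine ⟨V ⊓ V', inf_le_left.trans h₁, inf_le_left.trans h₂, ⟨hx, hx'⟩,
    A.obj.map (homOfLE inf_le_left).op s, A.obj.map (homOfLE inf_le_right).op s',
    ⟨?_, ?_⟩, ?_, ?_⟩
  · exact (m₁.ev_res h₁ inf_le_left s ⟨x, hx, hx'⟩).trans hf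
  · exact (m₂.ev_res h₂ inf_le_left s ⟨x, hx, hx'⟩).trans hg
  · exact (m₁.ev_res h₁' inf_le_right s' ⟨x, hx, hx'⟩).trans hf'
  · exact (m₂.ev_res h₂' inf_le_right s' ⟨x, hx, hx'⟩).trans hg'

theorem exists_sendsGerm (m₁ : GermModel A U₁ 𝓘(ℂ, Cn d₁) ι₁) (m₂ : GermModel A U₂ 𝓘(ℂ, Cn d₂) ι₂)
    (hx₁ : x ∈ U₁)
    (hx₂ : x ∈ U₂) {f : N₁ → ℂ} (hf : ContMDiffAt 𝓘(ℂ, Cn d₁) 𝓘(ℂ, ℂ) ω f (ι₁ x)) :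
    ∃ g : N₂ → ℂ, ∀ᶠ y in 𝓝 x, SendsGerm m₁ m₂ y f g := by
  obtain ⟨V, hV, s, hx, hs⟩ := m₁.exists_section x hx₁ f hf
  obtain ⟨g, -, hg⟩ := m₂.exists_rep (V ⊓ U₂) inf_le_right (A.obj.map (homOfLE inf_le_left).op s)
    ⟨x, hx, hx₂⟩
  refine ⟨g, (eventually_subtype_iff (V := V ⊓ U₂) ⟨x, hx, hx₂⟩).1 ?_⟩
  filter_upwards [hg] with y hy
  exact ⟨V ⊓ U₂, inf_le_left.trans hV, inf_le_right, y.2, _,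
    (m₁.ev_res hV inf_le_left s y).trans (hs _), hy⟩

/-- Single-valuedness holds because sections with equal germs in the first model coincide near x,
and so have equal germs in the second. This makes the local core applicable to sheaves. -/
theorem isGermHom_sendsGerm (m₁ : GermModel A U₁ 𝓘(ℂ, Cn d₁) ι₁)
    (m₂ : GermModel A U₂ 𝓘(ℂ, Cn d₂) ι₂) (hx₁ : x ∈ U₁)
    (hx₂ : x ∈ U₂) : IsGermHom (d₁ := d₁) (d₂ := d₂) (ι₁ x) (ι₂ x) (SendsGerm m₁ m₂ x) where
  contMDiffAt := by
    rintro f g ⟨V, h₁, h₂, hx, s, hf, hg⟩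
    exact m₂.contMDiffAt_of_ev_eq hg
  contMDiffAt_left := by
    rintro f g ⟨V, h₁, h₂, hx, s, hf, hg⟩
    exact m₁.contMDiffAt_of_ev_eq hf
  exists_rel := fun hf => by
    obtain ⟨g, hg⟩ := exists_sendsGerm m₁ m₂ hx₁ hx₂ hf
    exact ⟨g, hg.self_of_nhds⟩
  unique := by
    intro f f' g g' h h' hff'
    obtain ⟨V, h₁, h₂, hx, s, s', ⟨hf, hg⟩, hf', hg'⟩ := h.exists_common h'
    obtain ⟨W, hW, hxW, hs⟩ := m₁.eq_of_ev_eq V h₁ s s' ⟨x, hx⟩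
      (by rw [hf, hf', Filter.Germ.coe_eq.2 hff'])
    have e₁ := m₂.ev_res h₂ hW s ⟨x, hxW⟩
    have e₂ := m₂.ev_res h₂ hW s' ⟨x, hxW⟩
    rw [hs] at e₁
    exact Filter.Germ.coe_eq.1 (hg.symm.trans (e₁.symm.trans (e₂.trans hg')))
  const := fun c => ⟨U₁ ⊓ U₂, inf_le_left, inf_le_right, ⟨hx₁, hx₂⟩, algebraMap ℂ _ c, by
      rw [AlgHom.commutes]
      exact Filter.Germ.complexAlgebraMap_eq _ c, by
      rw [AlgHom.commutes]
      exact Filter.Germ.complexAlgebraMap_eq _ c⟩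
  add := by
    intro f f' g g' h h'
    obtain ⟨V, h₁, h₂, hx, s, s', ⟨hf, hg⟩, hf', hg'⟩ := h.exists_common h'
    refine ⟨V, h₁, h₂, hx, s + s', ?_, ?_⟩
    · rw [map_add, Pi.add_apply, hf, hf', Filter.Germ.coe_add]
    · rw [map_add, Pi.add_apply, hg, hg', Filter.Germ.coe_add]
  mul := by
    intro f f' g g' h h'
    obtain ⟨V, h₁, h₂, hx, s, s', ⟨hf, hg⟩, hf', hg'⟩ := h.exists_common h'
    refine ⟨V, h₁, h₂, hx, s * s', ?_, ?_⟩
    · rw [map_mul, Pi.mul_apply, hf, hf', Filter.Germ.coe_mul]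
    · rw [map_mul, Pi.mul_apply, hg, hg', Filter.Germ.coe_mul]

/-- Near `ι₂ x` the map `F` is holomorphic and it carries the second model to the first one. -/
structure IsTransition (m₁ : GermModel A U₁ 𝓘(ℂ, Cn d₁) ι₁) (m₂ : GermModel A U₂ 𝓘(ℂ, Cn d₂) ι₂)
    (x : M)
    (F : N₂ → N₁) : Prop where
  map_eq : F (ι₂ x) = ι₁ x
  contMDiffAt : ContMDiffAt 𝓘(ℂ, Cn d₂) 𝓘(ℂ, Cn d₁) ω F (ι₂ x)
  eventuallyEq_comp : ∀ {f : N₁ → ℂ} {g : N₂ → ℂ}, SendsGerm m₁ m₂ x f g → g =ᶠ[𝓝 (ι₂ x)] f ∘ F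

theorem IsTransition.congr {F G : N₂ → N₁} (h : IsTransition m₁ m₂ x F) (hFG : G =ᶠ[𝓝 (ι₂ x)] F) :
    IsTransition m₁ m₂ x G where
  map_eq := hFG.self_of_nhds.trans h.map_eq
  contMDiffAt := h.contMDiffAt.congr_of_eventuallyEq hFG
  eventuallyEq_comp hs := (h.eventuallyEq_comp hs).trans (hFG.fun_comp _).symm

theorem IsTransition.refl (m : GermModel A U₁ 𝓘(ℂ, Cn d₁) ι₁) : IsTransition m m x id where
  map_eq := rfl
  contMDiffAt := contMDiffAt_id
  eventuallyEq_comp := by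
    rintro f g ⟨V, h₁, h₂, hx, s, hf, hg⟩
    exact Filter.Germ.coe_eq.1 (hg.symm.trans hf)

/-- A section relating the outer germs has a germ in the middle model too, since x lies in its
domain; that germ splits the relation into two. -/
theorem IsTransition.comp {F : N₂ → N₁} {G : N₃ → N₂} (hF : IsTransition m₁ m₂ x F)
    (hG : IsTransition m₂ m₃ x G) (hx : x ∈ U₂) : IsTransition m₁ m₃ x (F ∘ G) where
  map_eq := by rw [Function.comp_apply, hG.map_eq, hF.map_eq]
  contMDiffAt := by
    refine ContMDiffAt.comp _ ?_ hG.contMDiffAt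
    rw [hG.map_eq]
    exact hF.contMDiffAt
  eventuallyEq_comp := by
    rintro f g ⟨V, h₁, h₃, hxV, s, hf, hg⟩
    obtain ⟨k, hk⟩ := Quotient.exists_rep
      (m₂.ev (V ⊓ U₂) inf_le_right (A.obj.map (homOfLE inf_le_left).op s) ⟨x, hxV, hx⟩)
    have e₁ : SendsGerm m₁ m₂ x f k := ⟨V ⊓ U₂, inf_le_left.trans h₁, inf_le_right, ⟨hxV, hx⟩,
      _, (m₁.ev_res h₁ inf_le_left s ⟨x, hxV, hx⟩).trans hf, hk.symm⟩
    have e₂ : SendsGerm m₂ m₃ x k g := ⟨V ⊓ U₂, inf_le_right, inf_le_left.trans h₃, ⟨hxV, hx⟩,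
      _, hk.symm, (m₃.ev_res h₃ inf_le_left s ⟨x, hxV, hx⟩).trans hg⟩
    refine (hG.eventuallyEq_comp e₂).trans ?_
    have ht : Filter.Tendsto G (𝓝 (ι₃ x)) (𝓝 (ι₂ x)) := by
      have := hG.contMDiffAt.continuousAt
      rwa [ContinuousAt, hG.map_eq] at this
    exact (hF.eventuallyEq_comp e₁).comp_tendsto ht

variable [IsManifold 𝓘(ℂ, Cn d₁) ω N₁]

/-- Both maps pull each coordinate at ι₁ x back to the germ that the models assign to it, and the
coordinates separate points of the chart domain. -/
theorem IsTransition.eventuallyEq {F G : N₂ → N₁} (hF : IsTransition m₁ m₂ x F)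
    (hG : IsTransition m₁ m₂ x G) (hx₁ : x ∈ U₁) (hx₂ : x ∈ U₂) : F =ᶠ[𝓝 (ι₂ x)] G := by
  have h : ∀ k, ∀ᶠ p in 𝓝 (ι₂ x), coordAt d₁ (ι₁ x) k (F p) = coordAt d₁ (ι₁ x) k (G p) := by
    intro k
    obtain ⟨g, hg⟩ := exists_sendsGerm m₁ m₂ hx₁ hx₂
      (contMDiffAt_coordAt (mem_chart_source (Cn d₁) (ι₁ x)) k)
    filter_upwards [hF.eventuallyEq_comp hg.self_of_nhds,
      hG.eventuallyEq_comp hg.self_of_nhds] with p h₁ h₂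
    exact h₁.symm.trans h₂
  have hsrc : ∀ {H : N₂ → N₁}, IsTransition m₁ m₂ x H →
      ∀ᶠ p in 𝓝 (ι₂ x), H p ∈ (extChartAt 𝓘(ℂ, Cn d₁) (ι₁ x)).source := by
    intro H hH
    refine hH.contMDiffAt.continuousAt.eventually_mem ?_
    rw [hH.map_eq]
    exact extChartAt_source_mem_nhds _
  filter_upwards [Filter.eventually_all.2 h, hsrc hF, hsrc hG] with p h₁ h₂ h₃
  exact (extChartAt 𝓘(ℂ, Cn d₁) (ι₁ x)).injOn h₂ h₃ (PiLp.ext h₁)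

variable [IsManifold 𝓘(ℂ, Cn d₂) ω N₂]

/-- The components of F are representatives of the images of the coordinates at ι₁ x. They represent
these images at all y near x, so a single F serves there; equality of values gives F (ι₂ y) = ι₁ y.
-/
theorem exists_isTransition (hv : SameValues m₁ m₂) (hx₁ : x ∈ U₁) (hx₂ : x ∈ U₂) :
    ∃ F : N₂ → N₁, ∀ᶠ y in 𝓝 x, IsTransition m₁ m₂ y F := by
  choose g hg using fun k => exists_sendsGerm m₁ m₂ hx₁ hx₂
    (contMDiffAt_coordAt (mem_chart_source (Cn d₁) (ι₁ x)) k)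
  set χ := extChartAt 𝓘(ℂ, Cn d₁) (ι₁ x) with hχ
  let G : N₂ → Cn d₁ := fun p => WithLp.toLp 2 fun k => g k p
  refine ⟨χ.symm ∘ G, ?_⟩
  filter_upwards [Filter.eventually_all.2 hg, U₁.isOpen.mem_nhds hx₁, U₂.isOpen.mem_nhds hx₂,
    (m₁.continuousAt x hx₁).eventually_mem ((chartAt (Cn d₁) (ι₁ x)).open_source.mem_nhds
      (mem_chart_source _ _))] with y hy hy₁ hy₂ hysrc
  have hysrc' : ι₁ y ∈ χ.source := by rwa [hχ, extChartAt_source]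
  have hR := isGermHom_sendsGerm m₁ m₂ hy₁ hy₂
  have hGy : G (ι₂ y) = χ (ι₁ y) := PiLp.ext fun k => ((hy k).value_eq hv).symm
  have hG : ContMDiffAt 𝓘(ℂ, Cn d₂) 𝓘(ℂ, Cn d₁) ω G (ι₂ y) :=
    ((EuclideanSpace.equiv (Fin d₁) ℂ).symm.contDiff (n := ω)).contMDiff.contMDiffAt.comp _
      (contMDiffAt_pi_space.2 fun k => hR.contMDiffAt (hy k))
  have htarget : χ.target ∈ 𝓝 (G (ι₂ y)) := by
    rw [hGy]
    exact extChartAt_target_mem_nhds' (χ.map_source hysrc')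
  have hF : ContMDiffAt 𝓘(ℂ, Cn d₂) 𝓘(ℂ, Cn d₁) ω (χ.symm ∘ G) (ι₂ y) :=
    ((contMDiffOn_extChartAt_symm _).contMDiffAt htarget).comp _ hG
  have hFy : (χ.symm ∘ G) (ι₂ y) = ι₁ y := by
    rw [Function.comp_apply, hGy, χ.left_inv hysrc']
  refine ⟨hFy, hF, fun {f g'} hfg => hR.eventuallyEq_comp hFy hysrc hF (fun k => ?_) hfg⟩
  refine (hy k).congr (Filter.EventuallyEq.refl _ _) ?_
  filter_upwards [hG.continuousAt.eventually_mem htarget] with p hp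
  simp only [Function.comp_apply, coordAt]
  rw [← hχ, χ.right_inv hp]

end GermModel

end GermModel

end HolNbhd

/-! ### From isomorphisms of inverse image sheaves to biholomorphic germs: part (ii) -/

namespace HolNbhd

theorem ContMDiffAt.exists_opens {E : Type*} [NormedAddCommGroup E] [NormedSpace ℂ E]
    {H : Type*} [TopologicalSpace H] {J : ModelWithCorners ℂ E H} {N : Type*} [TopologicalSpace N]
    [ChartedSpace H N] [IsManifold J ω N] {f : N → ℂ} {a : N} (hf : ContMDiffAt J 𝓘(ℂ, ℂ) ω f a) :
    ∃ W : Opens N, a ∈ W ∧ ContMDiffOn J 𝓘(ℂ, ℂ) ω f W := by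
  obtain ⟨u, hu, hfu⟩ := (contMDiffAt_iff_contMDiffOn_nhds (by simp)).1 hf
  obtain ⟨W, hWu, hW, ha⟩ := mem_nhds_iff.1 hu
  exact ⟨⟨W, hW⟩, ha, hfu.mono hWu⟩

section OfIso

variable {X : Type u} [TopologicalSpace X] {E : Type*} [NormedAddCommGroup E] [NormedSpace ℂ E]
  {H : Type*} [TopologicalSpace H] {J : ModelWithCorners ℂ E H} {N : Type u} [TopologicalSpace N]
  [ChartedSpace H N] {ι : X → N}

/-- The section of the inverse image sheaf given by the germs of a function that is holomorphic
on an open set. -/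
def germSection {V : Opens X} {W : Opens N} (hVW : ∀ x ∈ V, ι x ∈ W) {f : N → ℂ}
    (hf : ContMDiffOn J 𝓘(ℂ, ℂ) ω f W) : (inverseImage J ι).obj.obj (op V) :=
  ⟨fun _ => (f : (𝓝 _).Germ ℂ), fun x => ⟨W, f, hVW x x.2, hf, .of_forall fun _ => rfl⟩⟩

theorem iso_hom_inv_apply {A B : TopCat.Sheaf (AlgCat.{u} ℂ) (TopCat.of X)} (e : A ≅ B)
    (V : Opens X) (t : B.obj.obj (op V)) : e.hom.hom.app (op V) (e.inv.hom.app (op V) t) = t := by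
  exact ConcreteCategory.congr_hom (congrArg (fun f : B ⟶ B => f.hom.app (op V)) e.inv_hom_id) t

theorem iso_inv_hom_apply {A B : TopCat.Sheaf (AlgCat.{u} ℂ) (TopCat.of X)} (e : A ≅ B)
    (V : Opens X) (t : A.obj.obj (op V)) : e.inv.hom.app (op V) (e.hom.hom.app (op V) t) = t :=
  iso_hom_inv_apply e.symm V t

variable [IsManifold J ω N]

/-- An isomorphism with the inverse image of the sheaf of holomorphic functions is a model. -/
noncomputable def GermModel.ofIso {A : TopCat.Sheaf (AlgCat.{u} ℂ) (TopCat.of X)}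
    (hι : Continuous ι) (e : A ≅ inverseImage J ι) : GermModel A ⊤ J ι where
  ev V _ := (Subalgebra.val _).comp (e.hom.hom.app (op V)).hom
  continuousAt _ _ := hι.continuousAt
  ev_res := by
    intro V W hV h s x
    have := ConcreteCategory.congr_hom (e.hom.hom.naturality (homOfLE h).op) s
    exact congrFun (congrArg Subtype.val this) x
  exists_rep := by
    intro V hV s x
    obtain ⟨W, f, hxW, hf, hs⟩ := (e.hom.hom.app (op V) s).2 x
    exact ⟨f, hf.contMDiffAt (W.isOpen.mem_nhds hxW), hs⟩
  exists_section := by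
    intro x _ f hf
    obtain ⟨W, hxW, hfW⟩ := ContMDiffAt.exists_opens hf
    refine ⟨⟨ι ⁻¹' W, W.isOpen.preimage hι⟩, le_top,
      e.inv.hom.app _ (germSection (fun _ h => h) hfW), hxW, fun y => ?_⟩
    have := iso_hom_inv_apply e ⟨ι ⁻¹' W, W.isOpen.preimage hι⟩ (germSection (fun _ h => h) hfW)
    exact congrFun (congrArg Subtype.val this) y
  eq_of_ev_eq := by
    intro V hV s t x hst
    obtain ⟨W, f, hxW, hf, hs⟩ := (e.hom.hom.app (op V) s).2 x
    obtain ⟨W', f', hxW', hf', ht⟩ := (e.hom.hom.app (op V) t).2 x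
    have hff : f =ᶠ[𝓝 (ι x)] f' :=
      Filter.Germ.coe_eq.1 (hs.self_of_nhds.symm.trans (hst.trans ht.self_of_nhds))
    have hff' : ∀ᶠ y : V in 𝓝 x, f =ᶠ[𝓝 (ι y)] f' :=
      (hι.comp continuous_subtype_val).continuousAt.eventually
        (eventually_eventually_nhds.2 hff)
    have hst' : ∀ᶠ y : V in 𝓝 x, (e.hom.hom.app (op V) s).1 y = (e.hom.hom.app (op V) t).1 y := by
      filter_upwards [hs, ht, hff'] with y h₁ h₂ h₃
      exact h₁.trans ((Filter.Germ.coe_eq.2 h₃).trans h₂.symm)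
    obtain ⟨O, hO, hOo, hxO⟩ := eventually_nhds_iff.1 hst'
    have hO' := V.isOpen.isOpenEmbedding_subtypeVal.isOpenMap O hOo
    have hWV : (⟨Subtype.val '' O, hO'⟩ : Opens X) ≤ V := by
      rintro _ ⟨y, -, rfl⟩
      exact y.2
    -- Equality of germs at x spreads to the open set O; applying the inverse isomorphism turns
    -- equality of the families of germs over O into equality of sections.
    refine ⟨⟨Subtype.val '' O, hO'⟩, hWV, ⟨x, hxO, rfl⟩, ?_⟩
    rw [← iso_inv_hom_apply e _ (A.obj.map (homOfLE hWV).op s),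
      ← iso_inv_hom_apply e _ (A.obj.map (homOfLE hWV).op t)]
    congr 1
    refine (ConcreteCategory.congr_hom (e.hom.hom.naturality (homOfLE hWV).op) s).trans
      (Eq.trans ?_ (ConcreteCategory.congr_hom (e.hom.hom.naturality (homOfLE hWV).op) t).symm)
    refine Subtype.ext (funext fun y => ?_)
    obtain ⟨y, z, hz, rfl⟩ := y
    exact hO z hz

end OfIso

section Biholomorphic

variable {d₁ d₂ : ℕ} {M₁ : Type u} [TopologicalSpace M₁] [ChartedSpace (Cn d₁) M₁]
  {M₂ : Type u} [TopologicalSpace M₂] [ChartedSpace (Cn d₂) M₂]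
  {X : Type u} [TopologicalSpace X] {ι₁ : X → M₁} {ι₂ : X → M₂}

/-- The set of points near which `F` is holomorphic with left inverse `G`. -/
def leftInvDomain (F : M₂ → M₁) (G : M₁ → M₂) : Set M₂ :=
  {z | ∀ᶠ w in 𝓝 z, ContMDiffAt 𝓘(ℂ, Cn d₂) 𝓘(ℂ, Cn d₁) ω F w ∧ G (F w) = w}

/-- The largest open set on which `F` is a biholomorphic map with inverse `G`. -/
def biholomorphicDomain (d₁ d₂ : ℕ) {M₁ : Type u} [TopologicalSpace M₁] [ChartedSpace (Cn d₁) M₁]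
    {M₂ : Type u} [TopologicalSpace M₂] [ChartedSpace (Cn d₂) M₂] (F : M₂ → M₁) (G : M₁ → M₂) :
    Opens M₂ where
  carrier := {z | z ∈ leftInvDomain (d₁ := d₁) (d₂ := d₂) F G ∧
    F z ∈ leftInvDomain (d₁ := d₂) (d₂ := d₁) G F}
  is_open' := by
    rw [isOpen_iff_mem_nhds]
    rintro z ⟨h₁, h₂⟩
    exact Filter.inter_mem (eventually_eventually_nhds.2 h₁)
      (h₁.self_of_nhds.1.continuousAt (eventually_eventually_nhds.2 h₂))

theorem map_mem_biholomorphicDomain {F : M₂ → M₁} {G : M₁ → M₂} {z : M₂}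
    (hz : z ∈ biholomorphicDomain d₁ d₂ F G) : F z ∈ biholomorphicDomain d₂ d₁ G F := by
  refine ⟨hz.2, ?_⟩
  rw [hz.1.self_of_nhds.2]
  exact hz.1

theorem contMDiff_restrict_biholomorphicDomain (F : M₂ → M₁) (G : M₁ → M₂) :
    ContMDiff 𝓘(ℂ, Cn d₂) 𝓘(ℂ, Cn d₁) ω
      (fun z : biholomorphicDomain d₁ d₂ F G =>
        (⟨F z, map_mem_biholomorphicDomain z.2⟩ : biholomorphicDomain d₂ d₁ G F)) := by
  intro z
  exact (ChartedSpace.liftPropWithinAt_subtypeVal_comp_iff ..).1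
    (contMDiffAt_subtype_iff.2 z.2.1.self_of_nhds.1)

/-- A map that is locally biholomorphic along `X`, with global inverse `G`, restricts to
a biholomorphic map between neighbourhoods. -/
def NbhdBiholomorphism.ofInverse (F : M₂ → M₁) (G : M₁ → M₂)
    (hF : ∀ x, ι₂ x ∈ leftInvDomain (d₁ := d₁) (d₂ := d₂) F G)
    (hG : ∀ x, ι₁ x ∈ leftInvDomain (d₁ := d₂) (d₂ := d₁) G F) (hFι : ∀ x, F (ι₂ x) = ι₁ x) :
    NbhdBiholomorphism 𝓘(ℂ, Cn d₁) 𝓘(ℂ, Cn d₂) ι₁ ι₂ where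
  N₁ := biholomorphicDomain d₂ d₁ G F
  N₂ := biholomorphicDomain d₁ d₂ F G
  mem₁ x := ⟨hG x, by rw [← hFι, (hF x).self_of_nhds.2]; exact hF x⟩
  mem₂ x := ⟨hF x, by rw [hFι]; exact hG x⟩
  toDiffeomorph :=
    { toFun := fun z => ⟨F z, map_mem_biholomorphicDomain z.2⟩
      invFun := fun z => ⟨G z, map_mem_biholomorphicDomain z.2⟩
      left_inv := fun z => Subtype.ext z.2.1.self_of_nhds.2
      right_inv := fun z => Subtype.ext z.2.1.self_of_nhds.2
      contMDiff_toFun := contMDiff_restrict_biholomorphicDomain F G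
      contMDiff_invFun := contMDiff_restrict_biholomorphicDomain G F }
  map_ι x := Subtype.ext (hFι x)

/-- The biholomorphic map between empty neighbourhoods. -/
def NbhdBiholomorphism.ofIsEmpty [IsEmpty X] :
    NbhdBiholomorphism 𝓘(ℂ, Cn d₁) 𝓘(ℂ, Cn d₂) ι₁ ι₂ where
  N₁ := ⊥
  N₂ := ⊥
  mem₁ x := isEmptyElim x
  mem₂ x := isEmptyElim x
  toDiffeomorph :=
    { toFun := fun z => z.2.elim
      invFun := fun z => z.2.elim
      left_inv := fun z => z.2.elim
      right_inv := fun z => z.2.elim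
      contMDiff_toFun := fun z => z.2.elim
      contMDiff_invFun := fun z => z.2.elim }
  map_ι x := isEmptyElim x

variable [IsManifold 𝓘(ℂ, Cn d₁) ω M₁] [IsManifold 𝓘(ℂ, Cn d₂) ω M₂]

variable {A : TopCat.Sheaf (AlgCat.{u} ℂ) (TopCat.of X)}
  {m₁ : GermModel A ⊤ 𝓘(ℂ, Cn d₁) ι₁} {m₂ : GermModel A ⊤ 𝓘(ℂ, Cn d₂) ι₂}

/-- Local transition maps agree as germs along X by uniqueness, hence glue to one map along the
closed image. -/
theorem GermModel.exists_global_isTransition [T2Space M₂] [ParacompactSpace M₂] [Nonempty M₁]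
    (hι₂ : Topology.IsInducing ι₂) (hZ : IsClosed (Set.range ι₂)) (hv : SameValues m₁ m₂) :
    ∃ F : M₂ → M₁, ∀ x, IsTransition m₁ m₂ x F := by
  choose f hf using fun x => exists_isTransition (x := x) hv trivial trivial
  obtain ⟨F, hF⟩ := hι₂.exists_eventuallyEq_of_isClosed hZ f fun x => by
    filter_upwards [hf x] with y hy
    exact (hf y).self_of_nhds.eventuallyEq hy trivial trivial
  exact ⟨F, fun x => (hf x).self_of_nhds.congr (hF x)⟩

/-- G ∘ F is a transition from the second model to itself, and so is the identity; uniqueness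
identifies their germs. -/
theorem GermModel.IsTransition.mem_leftInvDomain {x : X} {F : M₂ → M₁} {G : M₁ → M₂}
    (hF : IsTransition m₁ m₂ x F) (hG : IsTransition m₂ m₁ x G) :
    ι₂ x ∈ leftInvDomain (d₁ := d₁) (d₂ := d₂) F G := by
  have h := (hG.comp hF trivial).eventuallyEq (.refl m₂) trivial trivial
  obtain ⟨u, hu, hFu⟩ := (contMDiffAt_iff_contMDiffOn_nhds (by simp)).1 hF.contMDiffAt
  filter_upwards [h, eventually_mem_nhds_iff.2 hu] with w h₁ h₂
  exact ⟨hFu.contMDiffAt h₂, h₁⟩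

end Biholomorphic

section Comparison

variable {d₁ d₂ : ℕ} {M₁ : Type u} [TopologicalSpace M₁] [ChartedSpace (Cn d₁) M₁]
  [IsManifold 𝓘(ℂ, Cn d₁) ω M₁]
  {M₂ : Type u} [TopologicalSpace M₂] [ChartedSpace (Cn d₂) M₂] [IsManifold 𝓘(ℂ, Cn d₂) ω M₂]
  {X : Type u} [TopologicalSpace X] {ι₁ : X → M₁} {ι₂ : X → M₂}
  {φ : inverseImage 𝓘(ℂ, Cn d₁) ι₁ ≅ inverseImage 𝓘(ℂ, Cn d₂) ι₂}

theorem exists_induces [T2Space M₁] [ParacompactSpace M₁] [T2Space M₂] [ParacompactSpace M₂]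
    (h₁ : Topology.IsEmbedding ι₁) (h₂ : Topology.IsEmbedding ι₂) (hc₁ : IsClosed (Set.range ι₁))
    (hc₂ : IsClosed (Set.range ι₂))
    (hv : (GermModel.ofIso h₁.continuous (Iso.refl _)).SameValues
      (GermModel.ofIso h₂.continuous φ)) :
    ∃ Φ : NbhdBiholomorphism 𝓘(ℂ, Cn d₁) 𝓘(ℂ, Cn d₂) ι₁ ι₂, Φ.Induces φ.hom := by
  -- Gluing produces globally defined maps, which requires nonempty targets.
  rcases isEmpty_or_nonempty X with hX | ⟨⟨x₀⟩⟩
  · exact ⟨.ofIsEmpty, fun U s x => (IsEmpty.false x.1).elim⟩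
  have : Nonempty M₁ := ⟨ι₁ x₀⟩
  have : Nonempty M₂ := ⟨ι₂ x₀⟩
  obtain ⟨F, hF⟩ := GermModel.exists_global_isTransition h₂.isInducing hc₂ hv
  obtain ⟨G, hG⟩ := GermModel.exists_global_isTransition h₁.isInducing hc₁
    (fun V h₁ h₂ s x => (hv V h₂ h₁ s x).symm)
  refine ⟨.ofInverse F G (fun x => (hF x).mem_leftInvDomain (hG x))
    (fun x => (hG x).mem_leftInvDomain (hF x)) fun x => (hF x).map_eq, ?_⟩
  intro U s x f g hf hg
  exact (eventually_subtype_iff (p := fun z => g z = f (F z)) _).2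
      ((hF x).eventuallyEq_comp ⟨U, le_top, le_top, x.2, s, hf, hg⟩)

-- Converse to the construction of Φ: an inducing biholomorphic map is a transition at every x, so
-- uniqueness of transitions gives uniqueness of Φ as a germ. The value ι₁ x outside Φ.N₂ plays no
-- role.
open Classical in
theorem NbhdBiholomorphism.Induces.isTransition
    {Φ : NbhdBiholomorphism 𝓘(ℂ, Cn d₁) 𝓘(ℂ, Cn d₂) ι₁ ι₂}
    (hΦ : Φ.Induces φ.hom) (h₁ : Continuous ι₁) (h₂ : Continuous ι₂) (x : X) :
    GermModel.IsTransition (GermModel.ofIso h₁ (Iso.refl _)) (GermModel.ofIso h₂ φ) x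
      fun z => if hz : z ∈ Φ.N₂ then (Φ.toDiffeomorph ⟨z, hz⟩ : M₁) else ι₁ x where
  map_eq := by rw [dif_pos (Φ.mem₂ x), Φ.map_ι]
  contMDiffAt := by
    refine (contMDiffAt_subtype_iff (x := (⟨ι₂ x, Φ.mem₂ x⟩ : Φ.N₂))).1 ?_
    refine ((contMDiff_subtype_val.comp Φ.toDiffeomorph.contMDiff).contMDiffAt).congr_of_eventuallyEq
      (.of_forall fun z => ?_)
    exact dif_pos z.2
  eventuallyEq_comp := by
    rintro f g ⟨V, _, _, hxV, s, hf, hg⟩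
    refine (eventually_subtype_iff (⟨ι₂ x, Φ.mem₂ x⟩ : Φ.N₂)).1 ?_
    filter_upwards [hΦ V s ⟨x, hxV⟩ f g hf hg] with z hz
    rw [hz, Function.comp_apply, dif_pos z.2]

theorem NbhdBiholomorphism.Induces.sameGerm
    {Φ Ψ : NbhdBiholomorphism 𝓘(ℂ, Cn d₁) 𝓘(ℂ, Cn d₂) ι₁ ι₂}
    (hΦ : Φ.Induces φ.hom) (hΨ : Ψ.Induces φ.hom) (h₁ : Continuous ι₁) (h₂ : Continuous ι₂) :
    Φ.SameGerm Ψ := by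
  classical
  have hW : ∀ {z}, z ∈ interior {z | ∃ (h : z ∈ Φ.N₂) (h' : z ∈ Ψ.N₂),
      (Φ.toDiffeomorph ⟨z, h⟩ : M₁) = Ψ.toDiffeomorph ⟨z, h'⟩} → _ := fun h => interior_subset h
  refine ⟨⟨_, isOpen_interior⟩, fun x => ?_, fun z hz => (hW hz).1, fun z hz => (hW hz).2.1,
    fun z => (hW z.2).2.2⟩
  refine mem_interior_iff_mem_nhds.2 ?_
  filter_upwards [Φ.N₂.isOpen.mem_nhds (Φ.mem₂ x), Ψ.N₂.isOpen.mem_nhds (Ψ.mem₂ x),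
    (hΦ.isTransition h₁ h₂ x).eventuallyEq (hΨ.isTransition h₁ h₂ x) trivial trivial] with z h h' he
  refine ⟨h, h', ?_⟩
  rwa [dif_pos (show z ∈ Φ.N₂ from h), dif_pos (show z ∈ Ψ.N₂ from h')] at he

end Comparison

end HolNbhd

/-! ### Cutting a complex manifold out of a topological space -/

namespace HolNbhd

section AmbientAtlas

/-- Data for cutting a complex manifold out of a topological space `T`: on each member of
a locally finite open cover there are coordinates with values in `E`, and there are
parametrizations of parts of `T` by `E`. -/
structure AmbientAtlas (T : Type*) [TopologicalSpace T] (I : Type*) (E : Type*)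
    [NormedAddCommGroup E] [NormedSpace ℂ E] where
  /-- the members of the cover -/
  dom : I → Set T
  isOpen_dom : ∀ i, IsOpen (dom i)
  exists_mem_dom : ∀ t, ∃ i, t ∈ dom i
  locallyFinite_dom : LocallyFinite dom
  /-- the coordinates -/
  coord : I → T → E
  continuousAt_coord : ∀ {i t}, t ∈ closure (dom i) → ContinuousAt (coord i) t
  /-- the parametrizations -/
  param : I → E → T
  /-- the values that the coordinates may take -/
  range : I → Set E
  isOpen_range : ∀ i, IsOpen (range i)

namespace AmbientAtlas

variable {T : Type*} [TopologicalSpace T] {I : Type*} {E : Type*}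
  [NormedAddCommGroup E] [NormedSpace ℂ E] (a : AmbientAtlas T I E)

/-- Near `p`, the `i`-th parametrization is inverse to the `i`-th coordinates, and it is related
to the `j`-th ones by a holomorphic change of coordinates. -/
def IsGoodAt (i j : I) (p : E) : Prop :=
  p ∈ a.range i ∧ ∀ᶠ q in 𝓝 p, ContinuousAt (a.param i) q ∧ a.coord i (a.param i q) = q ∧
    AnalyticAt ℂ (a.coord j ∘ a.param i) q ∧ a.param j (a.coord j (a.param i q)) = a.param i q

theorem IsGoodAt.eventually {i j : I} {p : E} (h : a.IsGoodAt i j p) :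
    ∀ᶠ q in 𝓝 p, a.IsGoodAt i j q :=
  ((a.isOpen_range i).eventually_mem h.1).and (eventually_eventually_nhds.2 h.2)

/-- The points of the ambient space at which all coordinates that are defined are inverse to the
corresponding parametrizations and are holomorphically related. -/
def carrier : Set T :=
  {t | ∀ i, t ∈ closure (a.dom i) → a.param i (a.coord i t) = t ∧
    ∀ j, t ∈ closure (a.dom j) → a.IsGoodAt i j (a.coord i t)}

variable {a}

theorem continuousAt_param {t : T} (ht : t ∈ a.carrier) {i : I} (hi : t ∈ closure (a.dom i)) :
    ContinuousAt (a.param i) (a.coord i t) :=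
  ((ht i hi).2 i hi).2.self_of_nhds.1

theorem tendsto_param {t : T} (ht : t ∈ a.carrier) {i : I} (hi : t ∈ closure (a.dom i)) :
    Filter.Tendsto (a.param i) (𝓝 (a.coord i t)) (𝓝 t) := by
  have := continuousAt_param ht hi
  rwa [ContinuousAt, (ht i hi).1] at this

/-- Since the closures form a locally finite closed family, points near t lie only in closures that
contain t. So membership near t amounts to finitely many conditions, all open along the
parametrization. This is why `carrier` is phrased with closures and why a chart has an open target.
-/
theorem eventually_param_mem_carrier {t : T} (ht : t ∈ a.carrier) {i : I}
    (hi : t ∈ closure (a.dom i)) : ∀ᶠ q in 𝓝 (a.coord i t), a.param i q ∈ a.carrier := by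
  have hlf := a.locallyFinite_dom.closure
  have hfin := hlf.point_finite t
  have h₁ : ∀ᶠ q in 𝓝 (a.coord i t), ∀ k, a.param i q ∈ closure (a.dom k) →
      t ∈ closure (a.dom k) :=
    (tendsto_param ht hi).eventually (hlf.eventually_subset (fun _ => isClosed_closure) t)
  have h₂ : ∀ᶠ q in 𝓝 (a.coord i t), ∀ k ∈ {k | t ∈ closure (a.dom k)},
      a.param k (a.coord k (a.param i q)) = a.param i q :=
    (Filter.eventually_all_finite hfin).2 fun k hk =>
      ((ht i hi).2 k hk).2.mono fun q hq => hq.2.2.2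
  have h₃ : ∀ᶠ q in 𝓝 (a.coord i t), ∀ k ∈ {k | t ∈ closure (a.dom k)},
      ∀ j ∈ {k | t ∈ closure (a.dom k)}, a.IsGoodAt k j (a.coord k (a.param i q)) :=
    (Filter.eventually_all_finite hfin).2 fun k hk => (Filter.eventually_all_finite hfin).2
      fun j hj => (tendsto_param ht hi).eventually
        ((a.continuousAt_coord hk).eventually (((ht k hk).2 j hj).eventually))
  filter_upwards [h₁, h₂, h₃] with q h₁ h₂ h₃ k hk
  exact ⟨h₂ k (h₁ k hk), fun j hj => h₃ k (h₁ k hk) j (h₁ j hj)⟩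

open Classical in
variable (a) in
/-- The chart of the carrier given by the `i`-th coordinates. -/
noncomputable def chart (i : I) (t₀ : a.carrier) : OpenPartialHomeomorph a.carrier E where
  toFun t := a.coord i t
  -- The point t₀ is a dummy value, used only outside the target.
  invFun q := if h : a.param i q ∈ a.carrier then ⟨_, h⟩ else t₀
  source := {t | t.1 ∈ a.dom i}
  target := {q | (a.param i q ∈ a.carrier ∧ a.param i q ∈ a.dom i) ∧ a.coord i (a.param i q) = q}
  map_source' := by
    intro t ht
    have h := (t.2 i (subset_closure ht)).1
    exact ⟨⟨h.symm ▸ t.2, h.symm ▸ ht⟩, congrArg (a.coord i) h⟩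
  map_target' := by
    rintro q ⟨⟨h₁, h₂⟩, -⟩
    rw [dif_pos h₁]
    exact h₂
  left_inv' := by
    intro t ht
    have h := (t.2 i (subset_closure ht)).1
    have h' : a.param i (a.coord i t) ∈ a.carrier := h.symm ▸ t.2
    rw [dif_pos h']
    exact Subtype.ext h
  right_inv' := by
    rintro q ⟨⟨h₁, h₂⟩, h₃⟩
    rw [dif_pos h₁]
    exact h₃
  open_source := (a.isOpen_dom i).preimage continuous_subtype_val
  open_target := by
    rw [isOpen_iff_mem_nhds]
    rintro q ⟨⟨h₁, h₂⟩, h₃⟩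
    have hcl := subset_closure h₂
    have e₁ := eventually_param_mem_carrier h₁ hcl
    have e₂ := (tendsto_param h₁ hcl).eventually_mem ((a.isOpen_dom i).mem_nhds h₂)
    have e₃ := ((h₁ i hcl).2 i hcl).2
    rw [h₃] at e₁ e₂ e₃
    filter_upwards [e₁, e₂, e₃] with p hp₁ hp₂ hp₃
    exact ⟨⟨hp₁, hp₂⟩, hp₃.2.1⟩
  continuousOn_toFun := fun t ht =>
    ((a.continuousAt_coord (subset_closure ht)).comp
      continuous_subtype_val.continuousAt).continuousWithinAt
  continuousOn_invFun := by
    rintro q ⟨⟨h₁, h₂⟩, h₃⟩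
    rw [Topology.IsInducing.subtypeVal.continuousWithinAt_iff]
    have e := continuousAt_param h₁ (subset_closure h₂)
    rw [h₃] at e
    refine e.continuousWithinAt.congr (fun p hp => ?_) ?_
    · rw [Function.comp_apply, dif_pos hp.1.1]
    · rw [Function.comp_apply, dif_pos h₁]

noncomputable instance : ChartedSpace E a.carrier where
  atlas := {e | ∃ i t₀, e = a.chart i t₀}
  chartAt t := a.chart (a.exists_mem_dom t).choose t
  mem_chart_source t := (a.exists_mem_dom t).choose_spec
  chart_mem_atlas t := ⟨_, t, rfl⟩

theorem chart_mem_atlas (i : I) (t₀ : a.carrier) : a.chart i t₀ ∈ atlas E a.carrier := ⟨i, t₀, rfl⟩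

/-- The change of charts is coord j ∘ param i, whose analyticity is part of `IsGoodAt`. -/
instance [CompleteSpace E] : IsManifold 𝓘(ℂ, E) ω a.carrier := by
  refine isManifold_of_contDiffOn _ _ _ ?_
  rintro _ _ ⟨i, t₀, rfl⟩ ⟨j, t₁, rfl⟩
  intro q hq
  simp only [mfld_simps] at hq
  obtain ⟨⟨h₁, h₂⟩, h₃⟩ : q ∈ (a.chart i t₀).target := hq.1
  have hq₂' : (a.chart i t₀).symm q = ⟨a.param i q, h₁⟩ := dif_pos h₁
  have hj : a.param i q ∈ a.dom j := by
    have : (a.chart i t₀).symm q ∈ (a.chart j t₁).source := hq.2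
    rwa [hq₂'] at this
  have h := ((h₁ i (subset_closure h₂)).2 j (subset_closure hj)).2.self_of_nhds.2.2.1
  rw [h₃] at h
  refine (h.contDiffAt.contDiffWithinAt).congr_of_mem (fun p hp => ?_) ?_
  · simp only [mfld_simps] at hp
    have hp' : p ∈ (a.chart i t₀).target := hp.1
    have : (a.chart i t₀).symm p = ⟨a.param i p, hp'.1.1⟩ := dif_pos hp'.1.1
    simp only [mfld_simps, this]
    rfl
  · simp only [mfld_simps]
    exact hq

end AmbientAtlas

/-- An ambient atlas together with a map from a complex manifold `M` that is given in coordinates by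
linear embeddings. -/
structure AdaptedAtlas (T : Type*) [TopologicalSpace T] (I : Type*) {m k : ℕ} {n : ℕ}
    (L : (Cn m × Cn n) ≃L[ℂ] Cn k) (M : Type*) [TopologicalSpace M] [ChartedSpace (Cn m) M] extends
    AmbientAtlas T I (Cn k) where
  /-- the charts of `M` -/
  χ : I → OpenPartialHomeomorph M (Cn m)
  χ_mem : ∀ i, χ i ∈ IsManifold.maximalAtlas 𝓘(ℂ, Cn m) ω M
  fst_mem_target : ∀ {i p}, p ∈ range i → (L.symm p).1 ∈ (χ i).target
  /-- the map to the ambient space -/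
  s : M → T
  continuous_s : Continuous s
  s_mem : ∀ x, s x ∈ toAmbientAtlas.carrier
  mem_source : ∀ {x i}, s x ∈ closure (dom i) → x ∈ (χ i).source
  coord_s : ∀ {x i}, s x ∈ closure (dom i) → coord i (s x) = L (χ i x, 0)
  param_eq : ∀ {x i}, x ∈ (χ i).source → param i (L (χ i x, 0)) = s x

namespace AdaptedAtlas

variable {T : Type*} [TopologicalSpace T] {I : Type*} {m k n : ℕ}
  {L : (Cn m × Cn n) ≃L[ℂ] Cn k} {M : Type*} [TopologicalSpace M] [ChartedSpace (Cn m) M]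
  (a : AdaptedAtlas T I L M)

/-- The map to the carrier. -/
def emb (x : M) : a.carrier := ⟨a.s x, a.s_mem x⟩

theorem continuous_emb : Continuous a.emb := a.continuous_s.subtype_mk _

/-- Over dom i, reading off the coordinates, projecting to `Cn m` and applying the inverse chart is
a local left inverse, continuous at the points of the image. -/
theorem isEmbedding_emb : Topology.IsEmbedding a.emb := by
  refine Topology.IsEmbedding.of_comp a.continuous_emb continuous_subtype_val ⟨?_, ?_⟩
  · rw [Topology.isInducing_iff_nhds]
    intro x
    refine le_antisymm (Filter.map_le_iff_le_comap.1 a.continuous_s.continuousAt) ?_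
    intro V hV
    obtain ⟨i, hi⟩ := a.exists_mem_dom (a.s x)
    have hcl := subset_closure hi
    have hg : ContinuousAt (fun t => (a.χ i).symm (L.symm (a.coord i t)).1) (a.s x) := by
      have h₁ : ContinuousAt (fun t => (L.symm (a.coord i t)).1) (a.s x) :=
        (continuous_fst.comp L.symm.continuous).continuousAt.comp (a.continuousAt_coord hcl)
      refine ContinuousAt.comp (g := (a.χ i).symm) ((a.χ i).symm.continuousAt ?_) h₁
      rw [a.coord_s hcl, L.symm_apply_apply]
      exact (a.χ i).map_source (a.mem_source hcl)
    have hval : ∀ {y}, a.s y ∈ a.dom i → (a.χ i).symm (L.symm (a.coord i (a.s y))).1 = y := by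
      intro y hy
      rw [a.coord_s (subset_closure hy), L.symm_apply_apply]
      exact (a.χ i).left_inv (a.mem_source (subset_closure hy))
    have hV' : V ∈ 𝓝 ((a.χ i).symm (L.symm (a.coord i (a.s x))).1) := by rwa [hval hi]
    refine ⟨_, Filter.inter_mem (hg hV') ((a.isOpen_dom i).mem_nhds hi), ?_⟩
    rintro y ⟨hy₁, hy₂⟩
    have := hval hy₂
    exact this ▸ hy₁
  · intro x y hxy
    have hxy' : a.s x = a.s y := hxy
    obtain ⟨i, hi⟩ := a.exists_mem_dom (a.s x)
    have hx := subset_closure hi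
    have hy := hxy' ▸ hx
    have e : L (a.χ i x, 0) = L (a.χ i y, 0) := by rw [← a.coord_s hx, ← a.coord_s hy, hxy']
    exact (a.χ i).injOn (a.mem_source hx) (a.mem_source hy) (Prod.ext_iff.1 (L.injective e)).1

/-- The `Cn n`-component of the coordinates vanishes on the image, hence at any limit point t in the
carrier. The condition on `range` then puts the other component in the target of a chart of M, and
the parametrization identifies t as the image of the corresponding point. -/
theorem isClosed_range_emb : IsClosed (Set.range a.emb) := by
  refine isClosed_of_closure_subset fun t ht => ?_
  obtain ⟨i, hi⟩ := a.exists_mem_dom t.1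
  have hcl := subset_closure hi
  have hcont : ContinuousAt (fun t' : a.carrier => (L.symm (a.coord i t')).2) t :=
    (continuous_snd.comp L.symm.continuous).continuousAt.comp
      ((a.continuousAt_coord hcl).comp continuous_subtype_val.continuousAt)
  have h0 : (L.symm (a.coord i t)).2 = 0 := by
    by_contra hne
    have e₁ := hcont.eventually_ne hne
    have e₂ : ∀ᶠ t' : a.carrier in 𝓝 t, t'.1 ∈ a.dom i :=
      ((a.isOpen_dom i).preimage continuous_subtype_val).mem_nhds hi
    obtain ⟨_, ⟨h₁, h₂⟩, x, rfl⟩ := mem_closure_iff_nhds.1 ht _ (e₁.and e₂)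
    refine h₁ ?_
    change (L.symm (a.coord i (a.s x))).2 = 0
    rw [a.coord_s (subset_closure h₂), L.symm_apply_apply]
  have hgood := t.2 i hcl
  have htgt := a.fst_mem_target (hgood.2 i hcl).1
  refine ⟨(a.χ i).symm (L.symm (a.coord i t)).1, Subtype.ext ?_⟩
  refine (a.param_eq ((a.χ i).map_target htgt)).symm.trans ?_
  rw [(a.χ i).right_inv htgt, ← h0, Prod.mk.eta, L.apply_symm_apply]
  exact hgood.1

/-- In the charts the map is y ↦ L (y, 0), the normal form of an immersion with complement `Cn n`.
-/
theorem isClosedHolEmbedding_emb [IsManifold 𝓘(ℂ, Cn m) ω M] :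
    IsClosedHolEmbedding 𝓘(ℂ, Cn m) 𝓘(ℂ, Cn k) a.emb where
  isClosed_range := a.isClosed_range_emb
  isSmoothEmbedding :=
    { isEmbedding := a.isEmbedding_emb
      isImmersion := by
        refine Manifold.IsImmersionOfComplement.isImmersion (F := Cn n) fun x => ?_
        obtain ⟨i, hi⟩ := a.exists_mem_dom (a.s x)
        have hO : IsOpen (a.s ⁻¹' a.dom i) := (a.isOpen_dom i).preimage a.continuous_s
        refine Manifold.IsImmersionAtOfComplement.mk_of_continuousAt
          a.continuous_emb.continuousAt L ((a.χ i).restr (a.s ⁻¹' a.dom i))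
          (a.chart i (a.emb x)) ?_ hi
          (restr_mem_maximalAtlas _ (a.χ_mem i) hO)
          (IsManifold.subset_maximalAtlas (AmbientAtlas.chart_mem_atlas i _)) ?_
        · rw [(a.χ i).restr_source' _ hO]
          exact ⟨a.mem_source (subset_closure hi), hi⟩
        · intro y hy
          simp only [mfld_simps] at hy
          rw [hO.interior_eq] at hy
          refine (a.coord_s (subset_closure hy.2)).trans ?_
          change L (a.χ i ((a.χ i).symm y), 0) = L (y, 0)
          rw [(a.χ i).right_inv hy.1] }

end AdaptedAtlas

end AmbientAtlas

end HolNbhd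

/-! ### The ambient metrizable space and the maps of the models into it -/

/-- A map to a space of functions with the topology of uniform convergence is continuous at a point
if all but finitely many components are locally constant, uniformly, and the others are
continuous. -/
theorem UniformFun.continuousAt_of_finite {X I β : Type*} [TopologicalSpace X] [UniformSpace β]
    {f : X → UniformFun I β} {x : X} {S : Set I} (hS : S.Finite)
    (h₀ : ∀ᶠ y in 𝓝 x, ∀ i ∉ S, UniformFun.toFun (f y) i = UniformFun.toFun (f x) i)
    (h : ∀ i ∈ S, ContinuousAt (fun y => UniformFun.toFun (f y) i) x) : ContinuousAt f x := by
  rw [ContinuousAt, UniformFun.tendsto_iff_tendstoUniformly]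
  intro u hu
  have h₁ : ∀ᶠ y in 𝓝 x, ∀ i ∈ S, (UniformFun.toFun (f x) i, UniformFun.toFun (f y) i) ∈ u :=
    (Filter.eventually_all_finite hS).2 fun i hi => Uniform.continuousAt_iff'_right.1 (h i hi) hu
  filter_upwards [h₀, h₁] with y hy₀ hy₁ i
  by_cases hi : i ∈ S
  · exact hy₁ i hi
  · simp only [Function.comp_apply, hy₀ i hi]
    exact refl_mem_uniformity hu

namespace HolNbhd

/-- A cover of `M` by charts with models of the sheaf `A`, the `i`-th one in terms of holomorphic
functions on `Cn k ≃ Cn m × Cn n` near the image of the `i`-th chart in `Cn m × 0`. -/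
structure ModelCover {M : Type u} [TopologicalSpace M] {m n k : ℕ} [ChartedSpace (Cn m) M]
    (A : TopCat.Sheaf (AlgCat.{u} ℂ) (TopCat.of M)) (L : (Cn m × Cn n) ≃L[ℂ] Cn k) where
  /-- the charts -/
  χ : M → OpenPartialHomeomorph M (Cn m)
  mem_source : ∀ x, x ∈ (χ x).source
  χ_mem : ∀ i, χ i ∈ IsManifold.maximalAtlas 𝓘(ℂ, Cn m) ω M
  /-- the models -/
  model : ∀ i, GermModel A ⟨(χ i).source, (χ i).open_source⟩ 𝓘(ℂ, Cn k) fun x => L (χ i x, 0)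
  sameValues : ∀ i j, (model i).SameValues (model j)

namespace ModelCover

variable {M : Type u} [TopologicalSpace M] {m n k : ℕ} [ChartedSpace (Cn m) M]
  {A : TopCat.Sheaf (AlgCat.{u} ℂ) (TopCat.of M)} {L : (Cn m × Cn n) ≃L[ℂ] Cn k}
  (D : ModelCover A L)

/-- The embedding of the domain of the `i`-th chart into `Cn k`. -/
noncomputable def c (i x : M) : Cn k := L (D.χ i x, 0)

theorem continuousAt_c {i x : M} (h : x ∈ (D.χ i).source) : ContinuousAt (D.c i) x :=
  (D.model i).continuousAt x h

/-- The projection of `Cn k` to `M` in the `i`-th chart. -/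
noncomputable def proj (i : M) (p : Cn k) : M := (D.χ i).symm (L.symm p).1

/-- The domain on which the `i`-th projection is meaningful. -/
def target (i : M) : Set (Cn k) := {p | (L.symm p).1 ∈ (D.χ i).target}

theorem isOpen_target (i : M) : IsOpen (D.target i) :=
  (D.χ i).open_target.preimage (continuous_fst.comp L.symm.continuous)

theorem c_mem_target {i x : M} (h : x ∈ (D.χ i).source) : D.c i x ∈ D.target i := by
  change (L.symm (L _)).1 ∈ (D.χ i).target
  rw [L.symm_apply_apply]
  exact (D.χ i).map_source h

theorem proj_c {i x : M} (h : x ∈ (D.χ i).source) : D.proj i (D.c i x) = x := by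
  change (D.χ i).symm (L.symm (L _)).1 = x
  rw [L.symm_apply_apply]
  exact (D.χ i).left_inv h

theorem continuousAt_proj {i : M} {p : Cn k} (h : p ∈ D.target i) : ContinuousAt (D.proj i) p :=
  ((D.χ i).symm.continuousAt h).comp (f := fun p => (L.symm p).1)
    (continuous_fst.comp L.symm.continuous).continuousAt

/-- For each pair i, j one map must represent the transition germs at all points of the overlap. The
image of the overlap in `Cn k` need not be closed, so the gluing lemma for metrizable spaces is
used. -/
theorem exists_transitions : ∃ F : M → M → Cn k → Cn k, ∀ i j x, x ∈ (D.χ i).source →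
    x ∈ (D.χ j).source → GermModel.IsTransition (D.model i) (D.model j) x (F i j) := by
  suffices h : ∀ i j, ∃ F : Cn k → Cn k, ∀ x, x ∈ (D.χ i).source →
      x ∈ (D.χ j).source → GermModel.IsTransition (D.model i) (D.model j) x F by
    choose F hF using h
    exact ⟨F, hF⟩
  intro i j
  let X := {x : (D.χ j).source // x.1 ∈ (D.χ i).source}
  have hind : Topology.IsInducing (fun x : X => D.c j x.1) :=
    (L.toHomeomorph.isInducing.comp (Topology.IsInducing.of_comp
      (f := fun y : Cn m => (y, (0 : Cn n))) (g := Prod.fst) (by fun_prop) continuous_fst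
        Topology.IsInducing.id)).comp
      ((D.χ j).isOpenEmbedding_restrict.isInducing.comp Topology.IsInducing.subtypeVal)
  have hex : ∀ x : X, _ := fun x =>
    GermModel.exists_isTransition (D.sameValues i j) (x := x.1.1) x.2 x.1.2
  choose f hf using hex
  have hev : ∀ x : X, ∀ᶠ y : X in 𝓝 x,
      GermModel.IsTransition (D.model i) (D.model j) y.1.1 (f x) := fun x =>
    (continuous_subtype_val.comp continuous_subtype_val).continuousAt.eventually (hf x)
  obtain ⟨F, hF⟩ := hind.exists_eventuallyEq_of_metrizable f fun x => by
    filter_upwards [hev x] with y hy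
    exact (hf y).self_of_nhds.eventuallyEq hy y.2 y.1.2
  exact ⟨F, fun x hi hj => (hf ⟨⟨x, hj⟩, hi⟩).self_of_nhds.congr (hF ⟨⟨x, hj⟩, hi⟩)⟩

end ModelCover

/-- A cover by models together with transition maps and a subordinate partition of unity. -/
structure WeightedModelCover {M : Type u} [TopologicalSpace M] {m n k : ℕ} [ChartedSpace (Cn m) M]
    (A : TopCat.Sheaf (AlgCat.{u} ℂ) (TopCat.of M)) (L : (Cn m × Cn n) ≃L[ℂ] Cn k) extends
    ModelCover A L where
  /-- the transition maps -/
  F : M → M → Cn k → Cn k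
  isTransition : ∀ {i j x}, x ∈ (χ i).source → x ∈ (χ j).source →
    GermModel.IsTransition (model i) (model j) x (F i j)
  /-- the partition of unity -/
  lam : PartitionOfUnity M M
  tsupport_subset : ∀ i, tsupport (lam i) ⊆ (χ i).source

theorem ModelCover.exists_weighted {M : Type u} [TopologicalSpace M] [T2Space M]
    [ParacompactSpace M] {m n k : ℕ} [ChartedSpace (Cn m) M]
    {A : TopCat.Sheaf (AlgCat.{u} ℂ) (TopCat.of M)} {L : (Cn m × Cn n) ≃L[ℂ] Cn k}
    (D : ModelCover A L) : ∃ D' : WeightedModelCover A L, D'.toModelCover = D := by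
  obtain ⟨F, hF⟩ := D.exists_transitions
  obtain ⟨lam, hlam⟩ := PartitionOfUnity.exists_isSubordinate isClosed_univ
    (fun i => (D.χ i).source) (fun i => (D.χ i).open_source)
    (fun x _ => Set.mem_iUnion.2 ⟨x, D.mem_source x⟩)
  exact ⟨{ D with F := F, isTransition := hF _ _ _, lam := lam, tsupport_subset := hlam }, rfl⟩

/-- The `i`-th coordinates on the ambient space. -/
noncomputable def ambientCoord {M : Type*} {k : ℕ} (i : M) (t : UniformFun M (ℝ × Cn k)) : Cn k :=
  (UniformFun.toFun t i).1⁻¹ • (UniformFun.toFun t i).2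

theorem continuous_eval {M : Type*} {k : ℕ} (i : M) :
    Continuous fun t : UniformFun M (ℝ × Cn k) => UniformFun.toFun t i :=
  (UniformFun.uniformContinuous_eval _ i).continuous

theorem continuousAt_ambientCoord {M : Type*} {k : ℕ} {i : M} {t : UniformFun M (ℝ × Cn k)}
    (h : (UniformFun.toFun t i).1 ≠ 0) : ContinuousAt (ambientCoord i) t :=
  ((continuous_fst.comp (continuous_eval i)).continuousAt.inv₀ h).smul
    (continuous_snd.comp (continuous_eval i)).continuousAt

namespace WeightedModelCover

variable {M : Type u} [TopologicalSpace M] {m n k : ℕ} [ChartedSpace (Cn m) M]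
  {A : TopCat.Sheaf (AlgCat.{u} ℂ) (TopCat.of M)} {L : (Cn m × Cn n) ≃L[ℂ] Cn k}
  (D : WeightedModelCover A L) {i j l x : M}

theorem F_c (hi : x ∈ (D.χ i).source) (hj : x ∈ (D.χ j).source) : D.F i j (D.c j x) = D.c i x :=
  (D.isTransition hi hj).map_eq

theorem analyticAt_F (hi : x ∈ (D.χ i).source) (hj : x ∈ (D.χ j).source) :
    AnalyticAt ℂ (D.F i j) (D.c j x) :=
  analyticWithinAt_univ.1 (contDiffWithinAt_omega_iff_analyticWithinAt.1
    (D.isTransition hi hj).contMDiffAt.contDiffAt.contDiffWithinAt)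

theorem tendsto_F (hi : x ∈ (D.χ i).source) (hj : x ∈ (D.χ j).source) :
    Filter.Tendsto (D.F i j) (𝓝 (D.c j x)) (𝓝 (D.c i x)) := by
  have := (D.analyticAt_F hi hj).continuousAt
  rwa [ContinuousAt, D.F_c hi hj] at this

/-- The cocycle condition holds by uniqueness of transitions, but only as an identity of germs along
M. -/
theorem F_comp (hi : x ∈ (D.χ i).source) (hj : x ∈ (D.χ j).source) (hl : x ∈ (D.χ l).source) :
    D.F i j ∘ D.F j l =ᶠ[𝓝 (D.c l x)] D.F i l :=
  ((D.isTransition hi hj).comp (D.isTransition hj hl) hj).eventuallyEq (D.isTransition hi hl) hi hl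

theorem F_self (hi : x ∈ (D.χ i).source) : D.F i i =ᶠ[𝓝 (D.c i x)] id :=
  (D.isTransition hi hi).eventuallyEq (.refl _) hi hi

theorem mem_source_of_mem_tsupport (h : x ∈ tsupport (D.lam i)) : x ∈ (D.χ i).source :=
  D.tsupport_subset i h

theorem mem_tsupport (h : D.lam i x ≠ 0) : x ∈ tsupport (D.lam i) := subset_closure h

theorem finite_tsupport (x : M) : {j | x ∈ tsupport (D.lam j)}.Finite :=
  D.lam.locallyFinite.closure.point_finite x

theorem eventually_mem_tsupport (x : M) :
    ∀ᶠ y in 𝓝 x, ∀ j, y ∈ tsupport (D.lam j) → x ∈ tsupport (D.lam j) :=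
  D.lam.locallyFinite.closure.eventually_subset (fun _ => isClosed_closure) x

/-- The weight functions, transported to `Cn k` by the charts. -/
noncomputable def weight (i : M) (p : Cn k) : ℝ := D.lam i (D.proj i p)

theorem weight_c (h : x ∈ (D.χ i).source) : D.weight i (D.c i x) = D.lam i x := by
  rw [weight, D.proj_c h]

theorem continuousAt_weight {p : Cn k} (h : p ∈ D.target i) : ContinuousAt (D.weight i) p :=
  (D.lam i).continuous.continuousAt.comp (D.continuousAt_proj h)

/-- Weighted coordinates of a point of `Cn k`. -/
noncomputable def weighted (i : M) (p : Cn k) : ℝ × Cn k := (D.weight i p, D.weight i p • p)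

open Classical in
/-- The local embedding into the ambient space in the `i`-th chart near the point `x`: the family of
weighted coordinates with respect to the finitely many charts `j` with `x` in the support of the
`j`-th weight. -/
noncomputable def piece (i x : M) (p : Cn k) : UniformFun M (ℝ × Cn k) :=
  UniformFun.ofFun fun j => if x ∈ tsupport (D.lam j) then D.weighted j (D.F j i p) else 0

/-- The map from `M` to the ambient space. -/
noncomputable def sec (x : M) : UniformFun M (ℝ × Cn k) :=
  UniformFun.ofFun fun j => (D.lam j x, D.lam j x • D.c j x)

theorem lam_eq_zero (h : x ∉ tsupport (D.lam j)) : D.lam j x = 0 :=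
  image_eq_zero_of_notMem_tsupport h

theorem continuous_sec : Continuous D.sec := by
  rw [continuous_iff_continuousAt]
  intro x
  refine UniformFun.continuousAt_of_finite (D.finite_tsupport x) ?_ fun j hj => ?_
  · filter_upwards [D.eventually_mem_tsupport x] with y hy j hj
    simp [sec, D.lam_eq_zero hj, D.lam_eq_zero (fun h => hj (hy j h))]
  · have h₁ := (D.lam j).continuous.continuousAt (x := x)
    exact h₁.prodMk (h₁.smul (D.continuousAt_c (D.mem_source_of_mem_tsupport hj)))

theorem piece_c (hi : x ∈ (D.χ i).source) : D.piece i x (D.c i x) = D.sec x := by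
  classical
  funext j
  change (if x ∈ tsupport (D.lam j) then D.weighted j (D.F j i (D.c i x)) else 0) =
    (D.lam j x, D.lam j x • D.c j x)
  split_ifs with h
  · have hj := D.mem_source_of_mem_tsupport h
    rw [D.F_c hj hi, weighted, D.weight_c hj]
  · simp [D.lam_eq_zero h, Prod.zero_eq_mk]

theorem eventually_weight_F_eq_zero (hi : x ∈ (D.χ i).source) (hj : x ∈ (D.χ j).source)
    (h : x ∉ tsupport (D.lam j)) : ∀ᶠ p in 𝓝 (D.c i x), D.weight j (D.F j i p) = 0 := by
  have h₁ : ∀ᶠ y in 𝓝 x, D.lam j y = 0 := by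
    filter_upwards [(isClosed_tsupport (D.lam j)).isOpen_compl.mem_nhds h] with y hy
    exact D.lam_eq_zero hy
  have h₂ := D.continuousAt_proj (D.c_mem_target hj)
  rw [ContinuousAt, D.proj_c hj] at h₂
  exact (h₂.comp (D.tendsto_F hj hi)).eventually h₁

/-- For y near x, the index set of `piece i y` lies in that of `piece i x`; the indices lost have
weight zero near the image of y. So the pieces are compatible germs and can be glued. -/
theorem eventually_piece_eq (hi : x ∈ (D.χ i).source) :
    ∀ᶠ y in 𝓝 x, D.piece i y =ᶠ[𝓝 (D.c i y)] D.piece i x := by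
  classical
  have hsrc : ∀ᶠ y in 𝓝 x, ∀ j ∈ {j | x ∈ tsupport (D.lam j)}, y ∈ (D.χ j).source :=
    (Filter.eventually_all_finite (D.finite_tsupport x)).2 fun j hj =>
      (D.χ j).open_source.mem_nhds (D.mem_source_of_mem_tsupport hj)
  filter_upwards [D.eventually_mem_tsupport x, hsrc, (D.χ i).open_source.mem_nhds hi]
    with y hy₁ hy₂ hy₃
  have h : ∀ᶠ p in 𝓝 (D.c i y), ∀ j ∈ {j | x ∈ tsupport (D.lam j)}, y ∉ tsupport (D.lam j) →
      D.weight j (D.F j i p) = 0 :=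
    (Filter.eventually_all_finite (D.finite_tsupport x)).2 fun j hj =>
      Filter.eventually_imp_distrib_left.2 fun hyj =>
        D.eventually_weight_F_eq_zero hy₃ (hy₂ j hj) hyj
  filter_upwards [h] with p hp
  funext j
  change (if y ∈ tsupport (D.lam j) then D.weighted j (D.F j i p) else 0) =
    if x ∈ tsupport (D.lam j) then D.weighted j (D.F j i p) else 0
  by_cases hxj : x ∈ tsupport (D.lam j)
  · by_cases hyj : y ∈ tsupport (D.lam j)
    · rw [if_pos hxj, if_pos hyj]
    · rw [if_pos hxj, if_neg hyj]
      simp [weighted, hp j hxj hyj, Prod.zero_eq_mk]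
  · rw [if_neg hxj, if_neg fun h => hxj (hy₁ j h)]

theorem eventually_continuousAt_piece (hi : x ∈ (D.χ i).source) :
    ∀ᶠ p in 𝓝 (D.c i x), ContinuousAt (D.piece i x) p := by
  classical
  have h₁ : ∀ᶠ p in 𝓝 (D.c i x), ∀ j ∈ {j | x ∈ tsupport (D.lam j)},
      AnalyticAt ℂ (D.F j i) p ∧ D.F j i p ∈ D.target j :=
    (Filter.eventually_all_finite (D.finite_tsupport x)).2 fun j hj => by
      have hj' := D.mem_source_of_mem_tsupport hj
      exact (D.analyticAt_F hj' hi).eventually_analyticAt.and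
        ((D.tendsto_F hj' hi).eventually_mem ((D.isOpen_target j).mem_nhds (D.c_mem_target hj')))
  filter_upwards [h₁] with p hp
  refine UniformFun.continuousAt_of_finite (D.finite_tsupport x)
    (Filter.Eventually.of_forall fun q j hj => ?_) fun j hj => ?_
  · change (if x ∈ tsupport (D.lam j) then D.weighted j (D.F j i q) else 0) =
      if x ∈ tsupport (D.lam j) then D.weighted j (D.F j i p) else 0
    have hj' : x ∉ tsupport (D.lam j) := hj
    rw [if_neg hj', if_neg hj']
  · obtain ⟨ha, ht⟩ := hp j hj
    have hj' : x ∈ tsupport (D.lam j) := hj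
    simp only [piece, UniformFun.toFun_ofFun, if_pos hj']
    have hw : ContinuousAt (fun q => D.weight j (D.F j i q)) p :=
      ContinuousAt.comp (g := D.weight j) (D.continuousAt_weight ht) ha.continuousAt
    exact hw.prodMk (hw.smul ha.continuousAt)

/-- The cocycle condition in each of the finitely many relevant components: the images of different
models agree in the ambient space. -/
theorem piece_F (hi : x ∈ (D.χ i).source) (hj : x ∈ (D.χ j).source) :
    D.piece j x ∘ D.F j i =ᶠ[𝓝 (D.c i x)] D.piece i x := by
  classical
  have h : ∀ᶠ p in 𝓝 (D.c i x), ∀ l ∈ {l | x ∈ tsupport (D.lam l)},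
      (D.F l j ∘ D.F j i) p = D.F l i p :=
    (Filter.eventually_all_finite (D.finite_tsupport x)).2 fun l hl =>
      D.F_comp (D.mem_source_of_mem_tsupport hl) hj hi
  filter_upwards [h] with p hp
  funext l
  change (if x ∈ tsupport (D.lam l) then D.weighted l (D.F l j (D.F j i p)) else 0) =
    if x ∈ tsupport (D.lam l) then D.weighted l (D.F l i p) else 0
  split_ifs with hl
  · rw [← hp l hl]
    rfl
  · rfl

theorem ambientCoord_sec (h : D.lam i x ≠ 0) : ambientCoord i (D.sec x) = D.c i x :=
  inv_smul_smul₀ h _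

theorem eventually_ambientCoord_piece (h : D.lam i x ≠ 0) :
    ∀ᶠ p in 𝓝 (D.c i x), ambientCoord i (D.piece i x p) = p := by
  classical
  have hx := D.mem_tsupport h
  have hi := D.mem_source_of_mem_tsupport hx
  have hw : ∀ᶠ p in 𝓝 (D.c i x), D.weight i p ≠ 0 :=
    (D.continuousAt_weight (D.c_mem_target hi)).eventually_ne (by rwa [D.weight_c hi])
  filter_upwards [D.F_self hi, hw] with p hp hwp
  have : UniformFun.toFun (D.piece i x p) i = D.weighted i (D.F i i p) := if_pos hx
  rw [ambientCoord, this, hp]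
  exact inv_smul_smul₀ hwp _

theorem exists_param : ∃ σ : M → Cn k → UniformFun M (ℝ × Cn k),
    ∀ i x, x ∈ (D.χ i).source → σ i =ᶠ[𝓝 (D.c i x)] D.piece i x := by
  suffices h : ∀ i, ∃ σ : Cn k → UniformFun M (ℝ × Cn k),
      ∀ x, x ∈ (D.χ i).source → σ =ᶠ[𝓝 (D.c i x)] D.piece i x by
    choose σ hσ using h
    exact ⟨σ, hσ⟩
  intro i
  have hind : Topology.IsInducing (fun x : (D.χ i).source => D.c i x) :=
    (L.toHomeomorph.isInducing.comp (Topology.IsInducing.of_comp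
      (f := fun y : Cn m => (y, (0 : Cn n))) (g := Prod.fst) (by fun_prop) continuous_fst
        Topology.IsInducing.id)).comp (D.χ i).isOpenEmbedding_restrict.isInducing
  have : Nonempty (UniformFun M (ℝ × Cn k)) := ⟨D.sec i⟩
  obtain ⟨σ, hσ⟩ := hind.exists_eventuallyEq_of_metrizable (fun x => D.piece i x.1) fun x =>
    continuous_subtype_val.continuousAt.eventually (D.eventually_piece_eq x.2)
  exact ⟨σ, fun x hx => hσ ⟨x, hx⟩⟩

variable {D} in
theorem eventually_param_F {σ : M → Cn k → UniformFun M (ℝ × Cn k)}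
    (hσ : ∀ i x, x ∈ (D.χ i).source → σ i =ᶠ[𝓝 (D.c i x)] D.piece i x)
    (hi : x ∈ (D.χ i).source) (hj : x ∈ (D.χ j).source) :
    ∀ᶠ p in 𝓝 (D.c i x), σ j (D.F j i p) = σ i p := by
  filter_upwards [hσ i x hi, (D.tendsto_F hj hi).eventually (hσ j x hj), D.piece_F hi hj]
    with p h₁ h₂ h₃
  rw [h₁, h₂]
  exact h₃

variable {D} in
theorem eventually_ambientCoord_param {σ : M → Cn k → UniformFun M (ℝ × Cn k)}
    (hσ : ∀ i x, x ∈ (D.χ i).source → σ i =ᶠ[𝓝 (D.c i x)] D.piece i x)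
    (hi : x ∈ (D.χ i).source) (hj : D.lam j x ≠ 0) :
    ∀ᶠ p in 𝓝 (D.c i x), ambientCoord j (σ i p) = D.F j i p := by
  have hj' := D.mem_source_of_mem_tsupport (D.mem_tsupport hj)
  filter_upwards [(D.tendsto_F hj' hi).eventually (hσ j x hj'), eventually_param_F hσ hi hj',
    (D.tendsto_F hj' hi).eventually (D.eventually_ambientCoord_piece hj)] with p h₁ h₂ h₃
  rw [← h₂, h₁, h₃]

/-- The part of the ambient space on which some coordinates are defined. -/
abbrev _root_.HolNbhd.Ambient (M : Type u) (k : ℕ) : Type u :=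
  {t : UniformFun M (ℝ × Cn k) // ∃ i, (UniformFun.toFun t i).1 ≠ 0}

theorem exists_lam_ne_zero (x : M) : ∃ i, D.lam i x ≠ 0 :=
  (D.lam.exists_pos (Set.mem_univ x)).imp fun _ h => h.ne'

theorem _root_.HolNbhd.isOpen_ambient (M : Type u) (k : ℕ) :
    IsOpen {t : UniformFun M (ℝ × Cn k) | ∃ i, (UniformFun.toFun t i).1 ≠ 0} := by
  rw [Set.ofPred_exists]
  exact isOpen_iUnion fun i => isOpen_ne_fun (continuous_fst.comp (continuous_eval i))
    continuous_const

/-- The reason for uniform convergence: it is metrizable for an index set of any size, unlike the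
product topology. -/
instance _root_.HolNbhd.metrizableSpace_ambient (M : Type u) (k : ℕ) :
    MetrizableSpace (Ambient M k) := inferInstance

/-- The map from `M` to the ambient space. -/
noncomputable def ambientSec (x : M) : Ambient M k := ⟨D.sec x, D.exists_lam_ne_zero x⟩

theorem exists_ambient_param : ∃ σ : M → Cn k → Ambient M k, ∀ i x, x ∈ (D.χ i).source →
    σ i (D.c i x) = D.ambientSec x ∧
    (∀ᶠ p in 𝓝 (D.c i x), ContinuousAt (σ i) p) ∧
    (∀ j, x ∈ (D.χ j).source → ∀ᶠ p in 𝓝 (D.c i x), σ j (D.F j i p) = σ i p) ∧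
    ∀ j, D.lam j x ≠ 0 → ∀ᶠ p in 𝓝 (D.c i x), ambientCoord j (σ i p).1 = D.F j i p := by
  classical
  obtain ⟨σ, hσ⟩ := D.exists_param
  let τ : M → Cn k → Ambient M k := fun i p =>
    -- The condition is open and holds on the image of M, so the dummy value is never taken near
    -- that image.
    if h : ∃ j, (UniformFun.toFun (σ i p) j).1 ≠ 0 then ⟨σ i p, h⟩ else D.ambientSec i
  have hσx : ∀ {i x}, x ∈ (D.χ i).source → σ i (D.c i x) = D.sec x := fun {i x} hx =>
    (hσ i x hx).self_of_nhds.trans (D.piece_c hx)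
  have hcont : ∀ {i x}, x ∈ (D.χ i).source → ∀ᶠ p in 𝓝 (D.c i x), ContinuousAt (σ i) p :=
    fun {i x} hx => by
      filter_upwards [D.eventually_continuousAt_piece hx, eventually_eventually_nhds.2 (hσ i x hx)]
        with p h₁ h₂
      exact h₁.congr (Filter.EventuallyEq.symm h₂)
  have hτ : ∀ {i x}, x ∈ (D.χ i).source → ∀ᶠ p in 𝓝 (D.c i x), (τ i p).1 = σ i p :=
    fun {i x} hx => by
      have := (hcont hx).self_of_nhds.eventually_mem
        ((isOpen_ambient M k).mem_nhds (by rw [hσx hx]; exact D.exists_lam_ne_zero x))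
      filter_upwards [this] with p hp
      simp only [τ]
      rw [dif_pos hp]
  refine ⟨τ, fun i x hi => ⟨Subtype.ext ((hτ hi).self_of_nhds.trans (hσx hi)), ?_, ?_, ?_⟩⟩
  · filter_upwards [hcont hi, eventually_eventually_nhds.2 (hτ hi)] with p h₁ h₂
    exact Topology.IsInducing.subtypeVal.continuousAt_iff.2
      (h₁.congr (Filter.EventuallyEq.symm h₂))
  · intro j hj
    filter_upwards [eventually_param_F hσ hi hj, hτ hi, (D.tendsto_F hj hi).eventually (hτ hj)]
      with p h₁ h₂ h₃
    exact Subtype.ext (h₃.trans (h₁.trans h₂.symm))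
  · intro j hj
    filter_upwards [eventually_ambientCoord_param hσ hi hj, hτ hi] with p h₁ h₂
    rw [h₂, h₁]

/-- Shrinking a locally finite refinement keeps the weights nonzero on the closures, where the
coordinates must be continuous. -/
theorem exists_ambient_cover (M : Type u) (k : ℕ) : ∃ O : M → Set (Ambient M k),
    (⋃ i, O i = Set.univ) ∧ (∀ i, IsOpen (O i)) ∧ LocallyFinite O ∧
      ∀ i t, t ∈ closure (O i) → (UniformFun.toFun t.1 i).1 ≠ 0 := by
  let _ := metrizableSpaceMetric (Ambient M k)
  obtain ⟨W, hWo, hWc, hWf, hW⟩ := precise_refinement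
    (fun i : M => {t : Ambient M k | (UniformFun.toFun t.1 i).1 ≠ 0})
    (fun i => isOpen_ne_fun
      ((continuous_fst.comp (continuous_eval i)).comp continuous_subtype_val) continuous_const)
    (Set.eq_univ_of_forall fun t => Set.mem_iUnion.2 t.2)
  obtain ⟨O, hOc, hOo, hO⟩ := exists_iUnion_eq_closure_subset hWo hWf.point_finite hWc
  exact ⟨O, hOc, hOo, hWf.subset fun i => subset_closure.trans (hO i),
    fun i t ht => hW i (hO i ht)⟩

/-- The image of M lies in the carrier because the transition identities hold near each of its
points. The added clause records that the changes of coordinates are the transition maps of the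
models, as is needed to glue the models. -/
theorem exists_adaptedAtlas : ∃ a : AdaptedAtlas (Ambient M k) M L M, ∀ i j x,
    a.s x ∈ a.dom i → a.s x ∈ a.dom j → x ∈ (D.χ i).source ∧ x ∈ (D.χ j).source ∧ 
      a.coord i (a.s x) = D.c i x ∧ D.F j i =ᶠ[𝓝 (D.c i x)] a.coord j ∘ a.param i := by
  obtain ⟨O, hOc, hOo, hOf, hO⟩ := exists_ambient_cover M k
  obtain ⟨σ, hσ⟩ := D.exists_ambient_param
  have hsrc : ∀ {i x}, D.ambientSec x ∈ closure (O i) → x ∈ (D.χ i).source := fun {i x} h =>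
    D.mem_source_of_mem_tsupport (D.mem_tsupport (hO i _ h))
  have hcoord : ∀ {i x}, D.ambientSec x ∈ closure (O i) →
      ambientCoord i (D.ambientSec x).1 = D.c i x := fun {i x} h => D.ambientCoord_sec (hO i _ h)
  refine ⟨
    { dom := O
      isOpen_dom := hOo
      exists_mem_dom := fun t => Set.mem_iUnion.1 (hOc ▸ Set.mem_univ t)
      locallyFinite_dom := hOf
      coord := fun i t => ambientCoord i t.1
      continuousAt_coord := fun ht => ContinuousAt.comp (g := ambientCoord _)
        (continuousAt_ambientCoord (hO _ _ ht)) continuous_subtype_val.continuousAt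
      param := σ
      range := D.target
      isOpen_range := D.isOpen_target
      χ := D.χ
      χ_mem := D.χ_mem
      fst_mem_target := fun h => h
      s := D.ambientSec
      continuous_s := D.continuous_sec.subtype_mk _
      s_mem := ?_
      mem_source := hsrc
      coord_s := hcoord
      param_eq := fun {x i} hx => (hσ i x hx).1 }, ?_⟩
  · intro x i hi
    have hxi := hsrc hi
    simp only [hcoord hi]
    refine ⟨(hσ i x hxi).1, fun j hj => ⟨D.c_mem_target hxi, ?_⟩⟩
    have hxj := hsrc hj
    obtain ⟨-, h₁, h₂, h₃⟩ := hσ i x hxi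
    have h₄ : ∀ᶠ p in 𝓝 (D.c i x), ambientCoord i (σ i p).1 = p := by
      filter_upwards [h₃ i (hO i _ hi), D.F_self hxi] with p hp hp'
      rw [hp, hp']
      rfl
    filter_upwards [h₁, h₂ j hxj, h₃ j (hO j _ hj), h₄,
      eventually_eventually_nhds.2 (h₃ j (hO j _ hj)),
      (D.analyticAt_F hxj hxi).eventually_analyticAt] with p h₁ h₂ h₃ h₄ h₅ h₆
    refine ⟨h₁, h₄, h₆.congr (Filter.EventuallyEq.symm h₅), ?_⟩
    rw [h₃, h₂]
  · intro i j x hi hj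
    have hi' := subset_closure hi
    have hj' := subset_closure hj
    exact ⟨hsrc hi', hsrc hj', hcoord hi',
      ((hσ i x (hsrc hi')).2.2.2 j (hO j _ hj')).mono fun p hp => hp.symm⟩

end WeightedModelCover

end HolNbhd

/-! ### Transporting the models to the glued manifold -/

namespace HolNbhd

/-- Pull-back of germs of functions. -/
def germPullback {X Y : Type*} {l : Filter X} {l' : Filter Y} (φ : X → Y)
    (h : Filter.Tendsto φ l l') : l'.Germ ℂ →ₐ[ℂ] l.Germ ℂ where
  toFun f := f.compTendsto φ h
  map_one' := rfl
  map_mul' f g := Filter.Germ.inductionOn₂ f g fun _ _ => rfl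
  map_zero' := rfl
  map_add' f g := Filter.Germ.inductionOn₂ f g fun _ _ => rfl
  commutes' c := by
    rw [Filter.Germ.complexAlgebraMap_eq, Filter.Germ.complexAlgebraMap_eq]
    rfl

theorem map_homOfLE_comp {M : Type u} [TopologicalSpace M]
    (A : TopCat.Sheaf (AlgCat.{u} ℂ) (TopCat.of M)) {U V W : Opens M} (h : W ≤ V) (h' : V ≤ U)
    (s : A.obj.obj (op U)) : A.obj.map (homOfLE h).op (A.obj.map (homOfLE h').op s) =
      A.obj.map (homOfLE (h.trans h')).op s := by
  rw [← ConcreteCategory.comp_apply, ← A.obj.map_comp]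
  rfl

namespace GermModel

section GermAt

variable {M : Type u} [TopologicalSpace M] {A : TopCat.Sheaf (AlgCat.{u} ℂ) (TopCat.of M)}
  {U : Opens M} {E : Type*} [NormedAddCommGroup E] [NormedSpace ℂ E] {H : Type*}
  [TopologicalSpace H] {J : ModelWithCorners ℂ E H} {N : Type*} [TopologicalSpace N]
  [ChartedSpace H N] {ι : M → N} (m : GermModel A U J ι)

/-- The germ at `x` of a section that need not be defined only on the domain of the model. -/
noncomputable def germAt (V : Opens M) {x : M} (hV : x ∈ V) (hU : x ∈ U) :
    A.obj.obj (op V) →ₐ[ℂ] (𝓝 (ι x)).Germ ℂ :=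
  (Pi.evalAlgHom ℂ (fun y : (V ⊓ U : Opens M) => (𝓝 (ι y)).Germ ℂ) ⟨x, hV, hU⟩).comp
    ((m.ev (V ⊓ U) inf_le_right).comp (A.obj.map (homOfLE inf_le_left).op).hom)

theorem germAt_eq_ev {V W : Opens M} {x : M} (hV : x ∈ V) (hW : x ∈ W) (hWV : W ≤ V) (hWU : W ≤ U)
    (s : A.obj.obj (op V)) :
    m.germAt V hV (hWU hW) s = m.ev W hWU (A.obj.map (homOfLE hWV).op s) ⟨x, hW⟩ := by
  have h := m.ev_res (V := V ⊓ U) (W := W) inf_le_right (le_inf hWV hWU)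
    (A.obj.map (homOfLE inf_le_left).op s) ⟨x, hW⟩
  rw [map_homOfLE_comp] at h
  exact h.symm

theorem germAt_of_le {V : Opens M} {x : M} (hV : x ∈ V) (hVU : V ≤ U) (s : A.obj.obj (op V)) :
    m.germAt V hV (hVU hV) s = m.ev V hVU s ⟨x, hV⟩ := by
  rw [m.germAt_eq_ev hV hV le_rfl hVU]
  exact m.ev_res hVU le_rfl s ⟨x, hV⟩

theorem germAt_res {V W : Opens M} {x : M} (hW : x ∈ W) (hWV : W ≤ V) (hU : x ∈ U)
    (s : A.obj.obj (op V)) :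
    m.germAt W hW hU (A.obj.map (homOfLE hWV).op s) = m.germAt V (hWV hW) hU s := by
  rw [m.germAt_eq_ev (W := W ⊓ U) hW ⟨hW, hU⟩ inf_le_left inf_le_right,
    m.germAt_eq_ev (W := W ⊓ U) (hWV hW) ⟨hW, hU⟩ (inf_le_left.trans hWV) inf_le_right,
    map_homOfLE_comp]

theorem exists_rep_germAt {V : Opens M} {x : M} (hV : x ∈ V) (hU : x ∈ U) (s : A.obj.obj (op V)) :
    ∃ f : N → ℂ, ContMDiffAt J 𝓘(ℂ, ℂ) ω f (ι x) ∧
      ∀ᶠ y in 𝓝 x, ∀ (hyV : y ∈ V) (hyU : y ∈ U), m.germAt V hyV hyU s = f := by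
  obtain ⟨f, hf, hev⟩ := m.exists_rep (V ⊓ U) inf_le_right (A.obj.map (homOfLE inf_le_left).op s)
    ⟨x, hV, hU⟩
  refine ⟨f, hf, ?_⟩
  rw [← (V ⊓ U).isOpen.isOpenEmbedding_subtypeVal.map_nhds_eq ⟨x, hV, hU⟩]
  exact Filter.eventually_map.2 (hev.mono fun y hy _ _ => hy)

theorem exists_res_eq_of_germAt_eq {V : Opens M} {x : M} {hV : x ∈ V} {hU : x ∈ U}
    {s t : A.obj.obj (op V)} (h : m.germAt V hV hU s = m.germAt V hV hU t) :
    ∃ (W : Opens M) (h : W ≤ V), x ∈ W ∧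
      A.obj.map (homOfLE h).op s = A.obj.map (homOfLE h).op t := by
  obtain ⟨W, hW, hxW, hst⟩ := m.eq_of_ev_eq (V ⊓ U) inf_le_right _ _ ⟨x, hV, hU⟩ h
  exact ⟨W, hW.trans inf_le_left, hxW, (map_homOfLE_comp A hW inf_le_left s).symm.trans
    (Eq.trans hst (map_homOfLE_comp A hW inf_le_left t))⟩

end GermAt

theorem SendsGerm.of_germAt {M : Type u} [TopologicalSpace M]
    {A : TopCat.Sheaf (AlgCat.{u} ℂ) (TopCat.of M)} {U₁ U₂ : Opens M} {d₁ d₂ : ℕ} {N₁ N₂ : Type*}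
    [TopologicalSpace N₁] [ChartedSpace (Cn d₁) N₁] [TopologicalSpace N₂] [ChartedSpace (Cn d₂) N₂]
    {ι₁ : M → N₁} {ι₂ : M → N₂} {m₁ : GermModel A U₁ 𝓘(ℂ, Cn d₁) ι₁}
    {m₂ : GermModel A U₂ 𝓘(ℂ, Cn d₂) ι₂} {V : Opens M} {x : M} {hV : x ∈ V} {h₁ : x ∈ U₁}
    {h₂ : x ∈ U₂} {s : A.obj.obj (op V)} {f : N₁ → ℂ} {g : N₂ → ℂ}
    (hf : m₁.germAt V hV h₁ s = f) (hg : m₂.germAt V hV h₂ s = g) : SendsGerm m₁ m₂ x f g := by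
  refine ⟨V ⊓ U₁ ⊓ U₂, inf_le_left.trans inf_le_right, inf_le_right, ⟨⟨hV, h₁⟩, h₂⟩,
    A.obj.map (homOfLE (inf_le_left.trans inf_le_left)).op s, ?_, ?_⟩
  · exact (m₁.germAt_eq_ev (W := V ⊓ U₁ ⊓ U₂) hV ⟨⟨hV, h₁⟩, h₂⟩ _ (inf_le_left.trans inf_le_right)
        s).symm.trans hf
  · exact (m₂.germAt_eq_ev (W := V ⊓ U₁ ⊓ U₂) hV ⟨⟨hV, h₁⟩, h₂⟩ _ inf_le_right s).symm.trans hg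

end GermModel

/-- An adapted atlas together with models in its charts such that the changes of coordinates are the
transition maps between the models. -/
structure ModelAtlas {M : Type u} [TopologicalSpace M] {m n k : ℕ} [ChartedSpace (Cn m) M]
    (A : TopCat.Sheaf (AlgCat.{u} ℂ) (TopCat.of M)) (L : (Cn m × Cn n) ≃L[ℂ] Cn k)
    (T I : Type*) [TopologicalSpace T] extends AdaptedAtlas T I L M where
  /-- the domains of the models -/
  U : I → Opens M
  /-- the embeddings into the models -/
  c : I → M → Cn k
  /-- the models -/
  model : ∀ i, GermModel A (U i) 𝓘(ℂ, Cn k) (c i)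
  mem_U : ∀ {i x}, s x ∈ dom i → x ∈ U i
  coord_eq_c : ∀ {i x}, s x ∈ dom i → coord i (s x) = c i x
  isTransition : ∀ {i j x}, s x ∈ dom i → s x ∈ dom j →
    GermModel.IsTransition (model j) (model i) x (coord j ∘ param i)

namespace ModelAtlas

variable {M : Type u} [TopologicalSpace M] {m n k : ℕ} [ChartedSpace (Cn m) M]
  {A : TopCat.Sheaf (AlgCat.{u} ℂ) (TopCat.of M)} {L : (Cn m × Cn n) ≃L[ℂ] Cn k}
  {T I : Type*} [TopologicalSpace T] (a : ModelAtlas A L T I)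

theorem tendsto_coord {i : I} {x : M} (h : a.s x ∈ a.dom i) :
    Filter.Tendsto (fun t : a.carrier => a.coord i t) (𝓝 (a.emb x)) (𝓝 (a.c i x)) := by
  have h' : ContinuousAt (fun t : a.carrier => a.coord i t) (a.emb x) :=
    ContinuousAt.comp (g := a.coord i) (f := Subtype.val)
      (a.continuousAt_coord (subset_closure h)) continuous_subtype_val.continuousAt
  rw [← a.coord_eq_c h]
  exact h'

/-- The germ on the carrier that is given by the `i`-th model. -/
noncomputable def germVia (i : I) (V : Opens M) {x : M} (hV : x ∈ V) (h : a.s x ∈ a.dom i) :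
    A.obj.obj (op V) →ₐ[ℂ] (𝓝 (a.emb x)).Germ ℂ :=
  (germPullback (fun t : a.carrier => a.coord i t) (a.tendsto_coord h)).comp
    ((a.model i).germAt V hV (a.mem_U h))

theorem germVia_eq {i : I} {V : Opens M} {x : M} {hV : x ∈ V} {h : a.s x ∈ a.dom i}
    {s : A.obj.obj (op V)} {f : Cn k → ℂ} (hf : (a.model i).germAt V hV (a.mem_U h) s = f) :
    a.germVia i V hV h s = ↑(fun t : a.carrier => f (a.coord i t)) := by
  rw [germVia, AlgHom.comp_apply, hf]
  rfl

theorem eventually_mem_dom {i : I} {x : M} (h : a.s x ∈ a.dom i) :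
    ∀ᶠ t : a.carrier in 𝓝 (a.emb x), t.1 ∈ a.dom i :=
  ((a.isOpen_dom i).preimage continuous_subtype_val).mem_nhds h

/-- The change of coordinates coord j ∘ param i is the transition between the models, so germs of
the same section match after pull-back; on the carrier, param i undoes coord i. -/
theorem germVia_eq_germVia {i j : I} {V : Opens M} {x : M} (hV : x ∈ V) (hi : a.s x ∈ a.dom i)
    (hj : a.s x ∈ a.dom j) (s : A.obj.obj (op V)) : a.germVia i V hV hi s = a.germVia j V hV hj s :=
        by
  obtain ⟨f, hf⟩ := Quotient.exists_rep ((a.model i).germAt V hV (a.mem_U hi) s)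
  obtain ⟨g, hg⟩ := Quotient.exists_rep ((a.model j).germAt V hV (a.mem_U hj) s)
  rw [a.germVia_eq hf.symm, a.germVia_eq hg.symm, Filter.Germ.coe_eq]
  have h := (a.isTransition hi hj).eventuallyEq_comp (GermModel.SendsGerm.of_germAt hg.symm hf.symm)
  filter_upwards [(a.tendsto_coord hi).eventually h, a.eventually_mem_dom hi] with t h₁ h₂
  rw [h₁]
  simp only [Function.comp_apply]
  rw [(t.2 i (subset_closure h₂)).1]

/-- A chart of the atlas around the image of a point. -/
noncomputable def idx (x : M) : I := (a.exists_mem_dom (a.s x)).choose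

theorem mem_dom_idx (x : M) : a.s x ∈ a.dom (a.idx x) := (a.exists_mem_dom (a.s x)).choose_spec

/-- The germ of a section, as a germ on the carrier. -/
noncomputable def germ (V : Opens M) {x : M} (hV : x ∈ V) :
    A.obj.obj (op V) →ₐ[ℂ] (𝓝 (a.emb x)).Germ ℂ :=
  a.germVia (a.idx x) V hV (a.mem_dom_idx x)

theorem germ_eq {i : I} {V : Opens M} {x : M} {hV : x ∈ V} (h : a.s x ∈ a.dom i)
    {s : A.obj.obj (op V)} {f : Cn k → ℂ} (hf : (a.model i).germAt V hV (a.mem_U h) s = f) :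
    a.germ V hV s = ↑(fun t : a.carrier => f (a.coord i t)) :=
  (a.germVia_eq_germVia hV _ h s).trans (a.germVia_eq hf)

theorem eventually_s_mem_dom {i : I} {x : M} (h : a.s x ∈ a.dom i) :
    ∀ᶠ y in 𝓝 x, a.s y ∈ a.dom i :=
  ((a.isOpen_dom i).preimage a.continuous_s).mem_nhds h

theorem contMDiffAt_coord {i : I} {t : a.carrier} (h : t.1 ∈ a.dom i) :
    ContMDiffAt 𝓘(ℂ, Cn k) 𝓘(ℂ, Cn k) ω (fun t : a.carrier => a.coord i t) t :=
  contMDiffAt_of_mem_maximalAtlas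
    (IsManifold.subset_maximalAtlas (AmbientAtlas.chart_mem_atlas i t)) h

/-- The models in the charts give a model on the carrier. -/
noncomputable def toGermModel : GermModel A ⊤ 𝓘(ℂ, Cn k) a.emb where
  ev V _ := AlgHom.pi fun x => a.germ V x.2
  continuousAt _ _ := a.continuous_emb.continuousAt
  ev_res := by
    intro V W _ h s x
    exact congrArg (germPullback _ (a.tendsto_coord (a.mem_dom_idx x)))
      ((a.model _).germAt_res x.2 h (a.mem_U (a.mem_dom_idx x)) s)
  exists_rep := by
    intro V _ s x
    have hi := a.mem_dom_idx x
    obtain ⟨f, hf, hev⟩ := (a.model (a.idx x)).exists_rep_germAt x.2 (a.mem_U hi) s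
    refine ⟨fun t => f (a.coord (a.idx x) t), ?_, ?_⟩
    · refine ContMDiffAt.comp _ ?_ (a.contMDiffAt_coord hi)
      change ContMDiffAt _ _ _ f (a.coord _ (a.s x))
      rwa [a.coord_eq_c hi]
    · have hev' : ∀ᶠ y : V in 𝓝 x, _ :=
        continuous_subtype_val.continuousAt.eventually (hev.and (a.eventually_s_mem_dom hi))
      filter_upwards [hev'] with y hy
      exact a.germ_eq hy.2 (hy.1 y.2 (a.mem_U hy.2))
  exists_section := by
    intro x _ f hf
    have hi := a.mem_dom_idx x
    set i := a.idx x
    let e := a.chart i (a.emb x)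
    have he : e ∈ IsManifold.maximalAtlas 𝓘(ℂ, Cn k) ω a.carrier :=
      IsManifold.subset_maximalAtlas (AmbientAtlas.chart_mem_atlas i _)
    have hex : e (a.emb x) = a.c i x := a.coord_eq_c hi
    have hf' : ContMDiffAt 𝓘(ℂ, Cn k) 𝓘(ℂ, ℂ) ω (f ∘ e.symm) (a.c i x) := by
      have h₁ : ContMDiffAt 𝓘(ℂ, Cn k) 𝓘(ℂ, Cn k) ω e.symm (e (a.emb x)) :=
        contMDiffAt_symm_of_mem_maximalAtlas he (e.map_source hi)
      rw [← hex]
      refine ContMDiffAt.comp _ ?_ h₁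
      rwa [e.left_inv hi]
    obtain ⟨V, hV, s, hxV, hs⟩ := (a.model i).exists_section x (a.mem_U hi) _ hf'
    let W : Opens M := V ⊓ ⟨a.s ⁻¹' a.dom i, (a.isOpen_dom i).preimage a.continuous_s⟩
    refine ⟨W, le_top, A.obj.map (homOfLE inf_le_left).op s, ⟨hxV, hi⟩, fun y => ?_⟩
    have hyi : a.s y ∈ a.dom i := y.2.2
    refine (a.germ_eq hyi (f := f ∘ e.symm) ?_).trans (Filter.Germ.coe_eq.2 ?_)
    · rw [(a.model i).germAt_res y.2, (a.model i).germAt_of_le y.2.1 hV, hs]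
    · filter_upwards [a.eventually_mem_dom hyi] with t ht
      exact congrArg f (e.left_inv ht)
  eq_of_ev_eq := by
    intro V _ s t x hst
    have hi := a.mem_dom_idx x
    set i := a.idx x with hidx
    let e := a.chart i (a.emb x)
    have hex : e (a.emb x) = a.c i x := a.coord_eq_c hi
    obtain ⟨f, hf⟩ := Quotient.exists_rep ((a.model i).germAt V x.2 (a.mem_U hi) s)
    obtain ⟨g, hg⟩ := Quotient.exists_rep ((a.model i).germAt V x.2 (a.mem_U hi) t)
    refine (a.model i).exists_res_eq_of_germAt_eq (hV := x.2) (hU := a.mem_U hi)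
      (hf.symm.trans (Eq.trans (Filter.Germ.coe_eq.2 ?_) hg))
    have h : (fun t : a.carrier => f (a.coord i t)) =ᶠ[𝓝 (a.emb x)] fun t => g (a.coord i t) :=
      Filter.Germ.coe_eq.1
        ((a.germ_eq hi hf.symm).symm.trans (hst.trans (a.germ_eq hi hg.symm)))
    have hsymm := e.tendsto_symm (x := a.emb x) hi
    rw [hex] at hsymm
    have htgt : ∀ᶠ p in 𝓝 (a.c i x), p ∈ e.target :=
      hex ▸ e.open_target.mem_nhds (e.map_source hi)
    filter_upwards [hsymm.eventually h, htgt] with p hp hp'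
    have hr : a.coord i (e.symm p) = p := e.right_inv hp'
    rwa [hr] at hp

theorem value_toGermModel {i : I} {V : Opens M} (hV : V ≤ a.U i) (s : A.obj.obj (op V)) (x : V)
    (h : a.s x ∈ a.dom i) :
    (a.toGermModel.ev V le_top s x).value = ((a.model i).ev V hV s x).value := by
  obtain ⟨f, hf⟩ := Quotient.exists_rep ((a.model i).germAt V x.2 (a.mem_U h) s)
  have h₁ : a.toGermModel.ev V le_top s x = _ := a.germ_eq h hf.symm
  rw [h₁, ← (a.model i).germAt_of_le x.2 hV, ← hf]
  exact congrArg f (a.coord_eq_c h)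

end ModelAtlas

theorem WeightedModelCover.exists_modelAtlas {M : Type u} [TopologicalSpace M] {m n k : ℕ}
    [ChartedSpace (Cn m) M] {A : TopCat.Sheaf (AlgCat.{u} ℂ) (TopCat.of M)}
    {L : (Cn m × Cn n) ≃L[ℂ] Cn k} (D : WeightedModelCover A L) :
    ∃ a : ModelAtlas A L (Ambient M k) M, 
      (∀ i x, a.s x ∈ a.dom i → x ∈ (D.χ i).source) ∧
      ∀ i (V : Opens M) (hV : V ≤ ⟨(D.χ i).source, (D.χ i).open_source⟩) (s : A.obj.obj (op V))
        (x : V), a.s x ∈ a.dom i → (a.toGermModel.ev V le_top s x).value =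
          ((D.model i).ev V hV s x).value := by
  obtain ⟨a, ha⟩ := D.exists_adaptedAtlas
  let a' : ModelAtlas A L (Ambient M k) M :=
    { a with
      U := fun i => ⟨(D.χ i).source, (D.χ i).open_source⟩
      c := D.c
      model := D.model
      mem_U := fun {i x} hx => (ha i i x hx hx).1
      coord_eq_c := fun {i x} hx => (ha i i x hx hx).2.2.1
      isTransition := fun {i j x} hi hj => by
        obtain ⟨h₁, h₂, -, h⟩ := ha i j x hi hj
        exact (D.isTransition h₂ h₁).congr h.symm }
  exact ⟨a', fun i x hx => (ha i i x hx hx).1, fun i V hV s x hx => a'.value_toGermModel hV s x hx⟩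

end HolNbhd

/-! ### From germ models to sheaf isomorphisms, and change of the ambient manifold -/

namespace HolNbhd

namespace GermModel

section ToIso

variable {M : Type u} [TopologicalSpace M] {A : TopCat.Sheaf (AlgCat.{u} ℂ) (TopCat.of M)}
  {E : Type*} [NormedAddCommGroup E] [NormedSpace ℂ E] {H : Type*} [TopologicalSpace H]
  {J : ModelWithCorners ℂ E H} {N : Type u} [TopologicalSpace N] [ChartedSpace H N]
  {ι : M → N}

theorem ext_of_ev_eq {U : Opens M} (m : GermModel A U J ι) {V : Opens M} (hV : V ≤ U)
    {s t : A.obj.obj (op V)} (h : m.ev V hV s = m.ev V hV t) : s = t := by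
  choose W hW hxW hst using fun x : V => m.eq_of_ev_eq V hV s t x (congrFun h x)
  exact A.eq_of_locally_eq' W V (fun x => homOfLE (hW x))
    (fun x hx => Opens.mem_iSup.2 ⟨⟨x, hx⟩, hxW ⟨x, hx⟩⟩) s t hst

variable [IsManifold J ω N]

/-- The morphism to the inverse image sheaf that sends a section to the family of its germs. -/
noncomputable def toInverseImage (m : GermModel A ⊤ J ι) : A ⟶ inverseImage J ι :=
  ⟨{ app := fun V => AlgCat.ofHom
      ((m.ev V.unop le_top).codRestrict _ fun s x => by
        obtain ⟨f, hf, hs⟩ := m.exists_rep V.unop le_top s x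
        obtain ⟨W, hxW, hfW⟩ := ContMDiffAt.exists_opens hf
        exact ⟨W, f, hxW, hfW, hs⟩)
     naturality := fun V W i => by
      refine ConcreteCategory.hom_ext _ _ fun s => Subtype.ext (funext fun x => ?_)
      exact m.ev_res le_top i.unop.le s x }⟩

/-- A section is determined by its germs, by locality of the sheaf. For surjectivity, a family of
germs lifts locally; the lifts agree on overlaps by injectivity, and so they glue. -/
theorem bijective_toInverseImage (m : GermModel A ⊤ J ι) (V : Opens M) :
    Function.Bijective (m.toInverseImage.hom.app (op V)) := by
  refine ⟨fun s t h => m.ext_of_ev_eq le_top (congrArg Subtype.val h), fun t => ?_⟩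
  have key : ∀ x : V, ∃ (W : Opens M) (h : W ≤ V) (s : A.obj.obj (op W)), x.1 ∈ W ∧
      ∀ y : W, m.ev W le_top s y = t.1 ⟨y, h y.2⟩ := by
    intro x
    obtain ⟨O, f, hxO, hf, ht⟩ := t.2 x
    obtain ⟨W, hW, s, hxW, hs⟩ := m.exists_section x trivial f
      (hf.contMDiffAt (O.isOpen.mem_nhds hxO))
    obtain ⟨Q, hQ, hQo, hxQ⟩ := eventually_nhds_iff.1 ht
    have hQ' := V.isOpen.isOpenEmbedding_subtypeVal.isOpenMap Q hQo
    refine ⟨W ⊓ ⟨Subtype.val '' Q, hQ'⟩, ?_, A.obj.map (homOfLE inf_le_left).op s,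
      ⟨hxW, x, hxQ, rfl⟩, ?_⟩
    · rintro _ ⟨-, y, -, rfl⟩
      exact y.2
    · rintro ⟨_, hy, y, hyQ, rfl⟩
      exact (m.ev_res le_top inf_le_left s _).trans ((hs _).trans (hQ y hyQ).symm)
  choose W hW s hxW hs using key
  obtain ⟨r, hr, -⟩ := A.existsUnique_gluing' W V (fun x => homOfLE (hW x))
    (fun x hx => Opens.mem_iSup.2 ⟨⟨x, hx⟩, hxW ⟨x, hx⟩⟩) s (fun x x' => by
      refine m.ext_of_ev_eq le_top (funext fun y => ?_)
      refine (m.ev_res le_top inf_le_left _ y).trans (Eq.trans ?_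
        (m.ev_res le_top inf_le_right _ y).symm)
      rw [hs, hs])
  refine ⟨r, Subtype.ext (funext fun x => ?_)⟩
  refine (m.ev_res le_top (hW x) r ⟨x, hxW x⟩).symm.trans ?_
  exact (congrFun (congrArg (m.ev (W x) le_top) (hr x)) _).trans (hs x ⟨x, hxW x⟩)

theorem isIso_toInverseImage (m : GermModel A ⊤ J ι) : IsIso m.toInverseImage := by
  have : ∀ V, IsIso (m.toInverseImage.hom.app V) := fun V =>
    (ConcreteCategory.isIso_iff_bijective _).2 (m.bijective_toInverseImage V.unop)
  have : IsIso m.toInverseImage.hom := NatIso.isIso_of_isIso_app _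
  exact ⟨⟨⟨inv m.toInverseImage.hom⟩, Sheaf.hom_ext (IsIso.hom_inv_id _),
    Sheaf.hom_ext (IsIso.inv_hom_id _)⟩⟩

theorem exists_iso {E₀ : Type*} [NormedAddCommGroup E₀] [NormedSpace ℂ E₀] {H₀ : Type*}
    [TopologicalSpace H₀] {I : ModelWithCorners ℂ E₀ H₀} [ChartedSpace H₀ M]
    (m : GermModel A ⊤ J ι) (hι : ContMDiff I J ω ι) (π : A ⟶ structureSheaf I M)
    (h : ∀ (V : Opens M) (s : A.obj.obj (op V)) (x : V),
      (m.ev V le_top s x).value = (π.hom.app (op V) s).1 x) :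
    ∃ e : A ≅ inverseImage J ι, e.hom ≫ sharp I J ι hι = π := by
  have := m.isIso_toInverseImage
  refine ⟨asIso m.toInverseImage, ?_⟩
  refine Sheaf.hom_ext (NatTrans.ext (funext fun V => ?_))
  exact ConcreteCategory.hom_ext _ _ fun s => Subtype.ext (funext fun x => h V.unop s x)

end ToIso

section Transfer

variable {M : Type u} [TopologicalSpace M] {A : TopCat.Sheaf (AlgCat.{u} ℂ) (TopCat.of M)}
  {U : Opens M}
  {E : Type*} [NormedAddCommGroup E] [NormedSpace ℂ E] {H : Type*} [TopologicalSpace H]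
  {J : ModelWithCorners ℂ E H} {N : Type*} [TopologicalSpace N] [ChartedSpace H N]
  {ι : U → N}
  {E' : Type*} [NormedAddCommGroup E'] [NormedSpace ℂ E'] {H' : Type*} [TopologicalSpace H']
  {J' : ModelWithCorners ℂ E' H'} {N' : Type*} [TopologicalSpace N'] [ChartedSpace H' N']
  {ι' : M → N'}

/-- The open subset of `U` cut out by an open subset of the ambient space. -/
def preimageOpens (U V : Opens M) : Opens U :=
    ⟨Subtype.val ⁻¹' V, V.isOpen.preimage continuous_subtype_val⟩

/-- The open subset of the ambient space that an open subset of `U` is. -/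
def imageOpens {U : Opens M} (V : Opens U) : Opens M :=
  ⟨(Subtype.val : U → M) '' (V : Set U), U.isOpen.isOpenEmbedding_subtypeVal.isOpenMap V V.isOpen⟩

theorem imageOpens_le {U : Opens M} {V : Opens U} {W : Opens M} (h : V ≤ preimageOpens U W) :
    imageOpens V ≤ W := by
  rintro _ ⟨y, hy, rfl⟩
  exact h hy

theorem imageOpens_mono {U : Opens M} {V W : Opens U} (h : V ≤ W) :
    imageOpens V ≤ imageOpens W := Set.image_mono h

/-- The restriction of a section to `U`. -/
noncomputable def resSection (A : TopCat.Sheaf (AlgCat.{u} ℂ) (TopCat.of M)) (U V : Opens M) :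
    A.obj.obj (op V) →ₐ[ℂ] ((restrict U).obj A).obj.obj (op (preimageOpens U V)) :=
  (A.obj.map (homOfLE (imageOpens_le le_rfl)).op).hom

theorem resSection_res {U V W : Opens M} (h : W ≤ V) (s : A.obj.obj (op V)) :
    resSection A U W (A.obj.map (homOfLE h).op s) =
      ((restrict U).obj A).obj.map (homOfLE (fun _ hx => h hx :
        preimageOpens U W ≤ preimageOpens U V)).op (resSection A U V s) :=
  (map_homOfLE_comp A _ h s).trans
    (map_homOfLE_comp A (imageOpens_mono fun _ hx => h hx) (imageOpens_le le_rfl) s).symm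

/-- A model over `U`, obtained from a model of the restriction to `U` by changing the ambient
manifold biholomorphically. -/
noncomputable def transfer (m : GermModel ((restrict U).obj A) ⊤ J ι) {U₁ : Opens M} (hU : U₁ ≤ U)
    (κ : N' → N) (κ' : N → N') (hι' : ∀ x ∈ U₁, ContinuousAt ι' x)
    (hκι : ∀ x (hx : x ∈ U₁), κ (ι' x) = ι ⟨x, hU hx⟩)
    (hκ'ι : ∀ x (hx : x ∈ U₁), κ' (ι ⟨x, hU hx⟩) = ι' x)
    (hκ : ∀ x ∈ U₁, ContMDiffAt J' J ω κ (ι' x))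
    (hκ' : ∀ x (hx : x ∈ U₁), ContMDiffAt J J' ω κ' (ι ⟨x, hU hx⟩))
    (hκκ' : ∀ x (hx : x ∈ U₁), ∀ᶠ p in 𝓝 (ι ⟨x, hU hx⟩), κ (κ' p) = p)
    (hκ'κ : ∀ x ∈ U₁, ∀ᶠ p in 𝓝 (ι' x), κ' (κ p) = p) :
    GermModel A U₁ J' ι' :=
  have ht : ∀ x (hx : x ∈ U₁), Filter.Tendsto κ (𝓝 (ι' x)) (𝓝 (ι ⟨x, hU hx⟩)) := fun x hx => by
    have := (hκ x hx).continuousAt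
    rwa [ContinuousAt, hκι x hx] at this
  have ht' : ∀ x (hx : x ∈ U₁), Filter.Tendsto κ' (𝓝 (ι ⟨x, hU hx⟩)) (𝓝 (ι' x)) := fun x hx => by
    have := (hκ' x hx).continuousAt
    rwa [ContinuousAt, hκ'ι x hx] at this
  { ev := fun V hV => AlgHom.pi fun x =>
      (germPullback κ (ht x (hV x.2))).comp ((Pi.evalAlgHom ℂ _
        (⟨⟨x, hU (hV x.2)⟩, x.2⟩ : preimageOpens U V)).comp
          ((m.ev (preimageOpens U V) le_top).comp (resSection A U V)))
    continuousAt := hι'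
    ev_res := by
      intro V W hV h s x
      refine congrArg (germPullback κ (ht x (hV (h x.2))))
        ((congrArg (fun r => m.ev (preimageOpens U W) le_top r
          ⟨⟨x, hU (hV (h x.2))⟩, x.2⟩) (resSection_res h s)).trans ?_)
      exact m.ev_res (W := preimageOpens U W) le_top (fun _ hx => h hx) (resSection A U V s)
        ⟨⟨x, hU (hV (h x.2))⟩, x.2⟩
    exists_rep := by
      intro V hV s x
      obtain ⟨f, hf, hs⟩ := m.exists_rep (preimageOpens U V) le_top (resSection A U V s)
        ⟨⟨x, hU (hV x.2)⟩, x.2⟩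
      refine ⟨f ∘ κ, ContMDiffAt.comp _ (by rwa [hκι x (hV x.2)]) (hκ x (hV x.2)), ?_⟩
      have hc : Continuous fun y : V => (⟨⟨y, hU (hV y.2)⟩, y.2⟩ : preimageOpens U V) :=
        (continuous_subtype_val.subtype_mk _).subtype_mk _
      filter_upwards [hc.continuousAt.eventually hs] with y hy
      exact congrArg (germPullback κ (ht y (hV y.2))) hy
    exists_section := by
      intro x hx f hf
      obtain ⟨V, hV, s, hxV, hs⟩ := m.exists_section ⟨x, hU hx⟩ trivial (f ∘ κ')
        (ContMDiffAt.comp _ (by rwa [hκ'ι x hx]) (hκ' x hx))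
      refine ⟨imageOpens V ⊓ U₁, inf_le_right, A.obj.map (homOfLE inf_le_left).op s,
        ⟨⟨_, hxV, rfl⟩, hx⟩, fun y => ?_⟩
      have hle : preimageOpens U (imageOpens V ⊓ U₁) ≤ V := by
        rintro z ⟨⟨w, hw, hwz⟩, -⟩
        rwa [← Subtype.ext hwz]
      have e : resSection A U _ (A.obj.map (homOfLE inf_le_left).op s) =
          ((restrict U).obj A).obj.map (homOfLE hle).op s := map_homOfLE_comp A _ _ s
      have e' : m.ev _ le_top (resSection A U _ (A.obj.map (homOfLE inf_le_left).op s))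
          ⟨⟨y, hU y.2.2⟩, y.2⟩ = ↑(f ∘ κ') :=
        (congrArg (fun r => m.ev _ le_top r ⟨⟨y, hU y.2.2⟩, y.2⟩) e).trans
          ((m.ev_res le_top hle s ⟨⟨y, hU y.2.2⟩, y.2⟩).trans (hs _))
      exact (congrArg (germPullback κ (ht y y.2.2)) e').trans
        (Filter.Germ.coe_eq.2 ((hκ'κ y y.2.2).mono fun p hp => congrArg f hp))
    eq_of_ev_eq := by
      intro V hV s t x h
      obtain ⟨W, hW, hxW, hst⟩ := m.eq_of_ev_eq (preimageOpens U V) le_top (resSection A U V s)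
        (resSection A U V t) ⟨⟨x, hU (hV x.2)⟩, x.2⟩ (by
          have h' := congrArg (germPullback κ' (ht' x (hV x.2))) h
          have key : ∀ g : (𝓝 (ι ⟨x, hU (hV x.2)⟩)).Germ ℂ,
              germPullback κ' (ht' x (hV x.2)) (germPullback κ (ht x (hV x.2)) g) = g := by
            exact fun g => Filter.Germ.inductionOn g fun g => Filter.Germ.coe_eq.2
              ((hκκ' x (hV x.2)).mono fun p hp => congrArg g hp)
          exact (key _).symm.trans (h'.trans (key _)))
      refine ⟨imageOpens W, imageOpens_le hW, ⟨_, hxW, rfl⟩, ?_⟩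
      exact (map_homOfLE_comp A (imageOpens_mono hW) (imageOpens_le le_rfl) s).symm.trans
        (Eq.trans hst (map_homOfLE_comp A (imageOpens_mono hW) (imageOpens_le le_rfl) t)) }

end Transfer

end GermModel

end HolNbhd

/-! ### Models from the local hypothesis, and existence: part (i) -/

namespace HolNbhd

section Retraction

variable {E : Type*} [NormedAddCommGroup E] [NormedSpace ℂ E] {H : Type*} [TopologicalSpace H]
  (I : ModelWithCorners ℂ E H) {M : Type*} [TopologicalSpace M] [ChartedSpace H M]

open Classical in
/-- A map to an open subset that is the identity there. -/
noncomputable def toOpens {U : Opens M} (x z : M) (hx : x ∈ U) : U :=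
  if h : z ∈ U then ⟨z, h⟩ else ⟨x, hx⟩

theorem toOpens_of_mem {U : Opens M} {x z : M} (hx : x ∈ U) (hz : z ∈ U) :
    toOpens x z hx = ⟨z, hz⟩ := dif_pos hz

theorem contMDiffAt_toOpens {U : Opens M} {x z : M} (hx : x ∈ U) (hz : z ∈ U) :
    ContMDiffAt I I ω (fun z => toOpens x z hx) z := by
  refine (ChartedSpace.liftPropWithinAt_subtypeVal_comp_iff ..).1 ?_
  refine (contMDiffAt_id : ContMDiffAt I I ω (id : M → M) z).congr_of_eventuallyEq ?_
  filter_upwards [U.isOpen.mem_nhds hz] with w hw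
  rw [Function.comp_apply, toOpens_of_mem hx hw]
  rfl

end Retraction

variable {m n k : ℕ} {M : Type u} [TopologicalSpace M] [ChartedSpace (Cn m) M]
  {A : TopCat.Sheaf (AlgCat.{u} ℂ) (TopCat.of M)}

theorem value_eq_of_comp_sharp {π : A ⟶ structureSheaf 𝓘(ℂ, Cn m) M} {U : Opens M}
    {e : (restrict U).obj A ≅ inverseImage (𝓘(ℂ, Cn m).prod 𝓘(ℂ, Cn n)) (zeroSection U n)}
    (he : e.hom ≫ sharp 𝓘(ℂ, Cn m) (𝓘(ℂ, Cn m).prod 𝓘(ℂ, Cn n)) (zeroSection U n)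
      (contMDiff_zeroSection 𝓘(ℂ, Cn m) n) =
        (restrict U).map π ≫ restrictStructureSheaf 𝓘(ℂ, Cn m) U)
    (V : Opens M) (s : A.obj.obj (op V)) (x : GermModel.preimageOpens U V) :
    ((e.hom.hom.app (op (GermModel.preimageOpens U V)) (GermModel.resSection A U V s)).1 x).value =
      (π.hom.app (op V) s).1 ⟨x, x.2⟩ := by
  have h₁ := ConcreteCategory.congr_hom
    (congrArg (fun f => f.hom.app (op (GermModel.preimageOpens U V))) he)
    (GermModel.resSection A U V s)
  have h₂ := ConcreteCategory.congr_hom (π.hom.naturality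
    (homOfLE (GermModel.imageOpens_le (le_refl (GermModel.preimageOpens U V)))).op) s
  refine (congrFun (congrArg Subtype.val h₁) x).trans ?_
  exact congrFun (congrArg Subtype.val h₂) ⟨x, x, x.2, rfl⟩

variable [IsManifold 𝓘(ℂ, Cn m) ω M]

/-- The local isomorphism lives over U × `Cn n`; a chart inside U and L move it to `Cn k`.
Compatibility with π fixes the values, so any two such models have the same values on overlaps. -/
theorem IsLocallyNeighbourhood.exists_model {π : A ⟶ structureSheaf 𝓘(ℂ, Cn m) M}
    (h : IsLocallyNeighbourhood 𝓘(ℂ, Cn m) n A π) (L : (Cn m × Cn n) ≃L[ℂ] Cn k) (x : M) :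
    ∃ χ : OpenPartialHomeomorph M (Cn m), x ∈ χ.source ∧
      χ ∈ IsManifold.maximalAtlas 𝓘(ℂ, Cn m) ω M ∧
      ∃ μ : GermModel A ⟨χ.source, χ.open_source⟩ 𝓘(ℂ, Cn k) fun y => L (χ y, 0),
        ∀ (V : Opens M) (hV : V ≤ ⟨χ.source, χ.open_source⟩) (s : A.obj.obj (op V)) (y : V),
          (μ.ev V hV s y).value = (π.hom.app (op V) s).1 y := by
  obtain ⟨U, hxU, e, he⟩ := h x
  let χ := (chartAt (Cn m) x).restr U
  have hsource : χ.source = (chartAt (Cn m) x).source ∩ U :=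
    OpenPartialHomeomorph.restr_source' _ _ U.isOpen
  have hχ : χ ∈ IsManifold.maximalAtlas 𝓘(ℂ, Cn m) ω M :=
    restr_mem_maximalAtlas _ (IsManifold.chart_mem_maximalAtlas x) U.isOpen
  have hU : (⟨χ.source, χ.open_source⟩ : Opens M) ≤ U := fun y hy => (hsource.le hy).2
  -- The maps κ and κ' are inverse only near the zero section; `toOpens` makes κ total.
  let κ : Cn k → U × Cn n := fun p => (toOpens x (χ.symm (L.symm p).1) hxU, (L.symm p).2)
  let κ' : U × Cn n → Cn k := fun q => L (χ q.1, q.2)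
  have hχat : ∀ y ∈ χ.source, ContMDiffAt 𝓘(ℂ, Cn m) 𝓘(ℂ, Cn m) ω χ y := fun y hy =>
    (contMDiffOn_of_mem_maximalAtlas hχ).contMDiffAt (χ.open_source.mem_nhds hy)
  have hκι : ∀ y (hy : y ∈ χ.source), κ (L (χ y, 0)) = zeroSection U n ⟨y, hU hy⟩ := by
    intro y hy
    simp only [κ, L.symm_apply_apply, χ.left_inv hy, toOpens_of_mem hxU (hU hy)]
    rfl
  have hκ'cont : ∀ y (hy : y ∈ χ.source), ContMDiffAt (𝓘(ℂ, Cn m).prod 𝓘(ℂ, Cn n)) 𝓘(ℂ, Cn k) ω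
      κ' (zeroSection U n ⟨y, hU hy⟩) := by
    intro y hy
    refine (L.contDiff (n := ω)).contMDiff.contMDiffAt.comp _ ?_
    refine ContMDiffAt.prodMk_space ?_ contMDiffAt_snd
    exact (ContMDiffAt.comp (g := χ) (f := fun q : U × Cn n => (q.1 : M)) _ (hχat y hy)
      (contMDiff_subtype_val.contMDiffAt.comp _ contMDiffAt_fst))
  have hκcont : ∀ y ∈ χ.source, ContMDiffAt 𝓘(ℂ, Cn k) (𝓘(ℂ, Cn m).prod 𝓘(ℂ, Cn n)) ω
      κ (L (χ y, 0)) := by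
    intro y hy
    have hL : ContMDiffAt 𝓘(ℂ, Cn k) 𝓘(ℂ, Cn m × Cn n) ω L.symm (L (χ y, 0)) :=
      (L.symm.contDiff (n := ω)).contMDiff.contMDiffAt
    have h₁ : ContMDiffAt 𝓘(ℂ, Cn k) 𝓘(ℂ, Cn m) ω (fun p => (L.symm p).1) (L (χ y, 0)) :=
      (contDiff_fst.contMDiff.contMDiffAt (n := ω)).comp _ hL
    have h₂ : ContMDiffAt 𝓘(ℂ, Cn k) 𝓘(ℂ, Cn n) ω (fun p => (L.symm p).2) (L (χ y, 0)) :=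
      (contDiff_snd.contMDiff.contMDiffAt (n := ω)).comp _ hL
    refine ContMDiffAt.prodMk ?_ h₂
    have h₃ : ContMDiffAt 𝓘(ℂ, Cn k) 𝓘(ℂ, Cn m) ω (fun p => χ.symm (L.symm p).1)
        (L (χ y, 0)) := by
      refine ContMDiffAt.comp (g := χ.symm) _ ?_ h₁
      refine (contMDiffOn_symm_of_mem_maximalAtlas hχ).contMDiffAt
        (χ.open_target.mem_nhds ?_)
      rw [L.symm_apply_apply]
      exact χ.map_source hy
    refine ContMDiffAt.comp (g := fun z => toOpens x z hxU) _ (contMDiffAt_toOpens _ hxU ?_) h₃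
    rw [L.symm_apply_apply, χ.left_inv hy]
    exact hU hy
  have hκκ' : ∀ y (hy : y ∈ χ.source), ∀ᶠ p in 𝓝 (zeroSection U n ⟨y, hU hy⟩),
      κ (κ' p) = p := by
    intro y hy
    have hc : Continuous fun q : U × Cn n => (q.1 : M) := continuous_subtype_val.comp continuous_fst
    filter_upwards [hc.continuousAt.eventually_mem (χ.open_source.mem_nhds hy)] with p hp
    simp only [κ, κ', L.symm_apply_apply, χ.left_inv hp, toOpens_of_mem hxU p.1.2]
  have hκ'κ : ∀ y ∈ χ.source, ∀ᶠ p in 𝓝 (L (χ y, 0)), κ' (κ p) = p := by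
    intro y hy
    have hc : Continuous fun p => (L.symm p).1 := continuous_fst.comp L.symm.continuous
    filter_upwards [hc.continuousAt.eventually_mem (χ.open_target.mem_nhds
      (by simpa only [L.symm_apply_apply] using χ.map_source hy))] with p hp
    simp only [κ, κ', toOpens_of_mem hxU (hU (χ.map_target hp)), χ.right_inv hp,
      Prod.mk.eta, L.apply_symm_apply]
  let μ := (GermModel.ofIso (contMDiff_zeroSection 𝓘(ℂ, Cn m) n).continuous e).transfer
    (J' := 𝓘(ℂ, Cn k)) (ι' := fun y => L (χ y, 0))
    hU κ κ' (fun y hy => L.continuous.continuousAt.comp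
      ((χ.continuousAt hy).prodMk continuousAt_const)) hκι (fun _ _ => rfl) hκcont hκ'cont hκκ' hκ'κ
  refine ⟨χ, hsource.ge ⟨mem_chart_source _ x, hxU⟩, hχ, μ, fun V hV s y => ?_⟩
  rw [← value_eq_of_comp_sharp he V s ⟨⟨y, hU (hV y.2)⟩, y.2⟩]
  have t : Filter.Tendsto κ (𝓝 (L (χ y, 0))) (𝓝 (zeroSection U n ⟨y, hU (hV y.2)⟩)) := by
    have := (hκcont y (hV y.2)).continuousAt
    rwa [ContinuousAt, hκι y (hV y.2)] at this
  have key : ∀ g : (𝓝 (zeroSection U n ⟨y, hU (hV y.2)⟩)).Germ ℂ,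
      Filter.Germ.value (germPullback κ t g) = g.value := fun g =>
    Filter.Germ.inductionOn g fun g => congrArg g (hκι y (hV y.2))
  exact key _

theorem IsLocallyNeighbourhood.exists_modelCover {π : A ⟶ structureSheaf 𝓘(ℂ, Cn m) M}
    (h : IsLocallyNeighbourhood 𝓘(ℂ, Cn m) n A π) (L : (Cn m × Cn n) ≃L[ℂ] Cn k) :
    ∃ D : ModelCover A L, ∀ (i : M) (V : Opens M) hV s (y : V),
      ((D.model i).ev V hV s y).value = (π.hom.app (op V) s).1 y := by
  choose χ hx hχ μ hμ using fun x => h.exists_model L x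
  exact ⟨⟨χ, hx, hχ, μ, fun i j V h₁ h₂ s y => (hμ i V h₁ s y).trans (hμ j V h₂ s y).symm⟩, hμ⟩

/-- A sheaf of algebras over the structure sheaf that has the right local form is the inverse image
of the structure sheaf of a complex manifold, along a closed embedding. -/
theorem IsLocallyNeighbourhood.exists_neighbourhood [T2Space M] [ParacompactSpace M]
    {π : A ⟶ structureSheaf 𝓘(ℂ, Cn m) M} (h : IsLocallyNeighbourhood 𝓘(ℂ, Cn m) n A π) :
    ∃ (M' : Type u) (_ : TopologicalSpace M') (_ : T2Space M') (_ : ParacompactSpace M')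
      (_ : ChartedSpace (Cn (m + n)) M') (_ : IsManifold 𝓘(ℂ, Cn (m + n)) ω M') (ι : M → M')
      (hι : IsClosedHolEmbedding 𝓘(ℂ, Cn m) 𝓘(ℂ, Cn (m + n)) ι)
      (e : A ≅ inverseImage 𝓘(ℂ, Cn (m + n)) ι),
      e.hom ≫ sharp 𝓘(ℂ, Cn m) 𝓘(ℂ, Cn (m + n)) ι hι.isSmoothEmbedding.contMDiff = π := by
  -- Any linear identification serves.
  have L : (Cn m × Cn n) ≃L[ℂ] Cn (m + n) := ContinuousLinearEquiv.ofFinrankEq (by simp)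
  obtain ⟨D, hD⟩ := h.exists_modelCover L
  obtain ⟨D, rfl⟩ := D.exists_weighted
  obtain ⟨a, has, ha⟩ := D.exists_modelAtlas
  -- This metric supplies the Hausdorff property and paracompactness of the new manifold.
  let _ : MetricSpace a.carrier := metrizableSpaceMetric _
  have hι := a.isClosedHolEmbedding_emb
  obtain ⟨e, he⟩ := a.toGermModel.exists_iso hι.isSmoothEmbedding.contMDiff π fun (V : Opens M) s x
      => by
    obtain ⟨i, hi⟩ := a.exists_mem_dom (a.emb x)
    have hxi := has i x hi
    let O : Opens M := ⟨(D.χ i).source, (D.χ i).open_source⟩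
    have h₁ := ha i (V ⊓ O) inf_le_right (A.obj.map (homOfLE inf_le_left).op s) ⟨x, x.2, hxi⟩ hi
    have h₂ := hD i (V ⊓ O) inf_le_right (A.obj.map (homOfLE inf_le_left).op s) ⟨x, x.2, hxi⟩
    have h₃ := a.toGermModel.ev_res (le_top : V ≤ ⊤) (inf_le_left : V ⊓ O ≤ V) s ⟨x, x.2, hxi⟩
    have h₄ := ConcreteCategory.congr_hom (π.hom.naturality
      (homOfLE (inf_le_left : V ⊓ O ≤ V)).op) s
    exact (congrArg Filter.Germ.value h₃).symm.trans (h₁.trans (h₂.trans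
      (congrFun (congrArg Subtype.val h₄) ⟨x, x.2, hxi⟩)))
  exact ⟨a.carrier, inferInstance, inferInstance, inferInstance, inferInstance, inferInstance,
    a.emb, hι, e, he⟩

end HolNbhd

/-! ### The theorem -/

/-- Existence and uniqueness of the neighbourhood germ of a complex manifold `M` that is determined
by a sheaf of algebras over `𝒪_M` of the right local form. -/
theorem theorem1 {m : ℕ} {M : Type u} [TopologicalSpace M] [T2Space M] [ParacompactSpace M]
    [ChartedSpace (HolNbhd.Cn m) M] [IsManifold 𝓘(ℂ, HolNbhd.Cn m) ω M] :
    (∀ (n : ℕ) (A : TopCat.Sheaf (AlgCat.{u} ℂ) (TopCat.of M))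
      (π : A ⟶ HolNbhd.structureSheaf 𝓘(ℂ, HolNbhd.Cn m) M),
      HolNbhd.IsLocallyNeighbourhood 𝓘(ℂ, HolNbhd.Cn m) n A π →
      ∃ (M' : Type u) (_ : TopologicalSpace M') (_ : T2Space M') (_ : ParacompactSpace M')
        (_ : ChartedSpace (HolNbhd.Cn (m + n)) M')
        (_ : IsManifold 𝓘(ℂ, HolNbhd.Cn (m + n)) ω M') (ι : M → M')
        (hι : HolNbhd.IsClosedHolEmbedding 𝓘(ℂ, HolNbhd.Cn m) 𝓘(ℂ, HolNbhd.Cn (m + n)) ι)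
        (e : A ≅ HolNbhd.inverseImage 𝓘(ℂ, HolNbhd.Cn (m + n)) ι),
        e.hom ≫ HolNbhd.sharp 𝓘(ℂ, HolNbhd.Cn m) 𝓘(ℂ, HolNbhd.Cn (m + n)) ι
          hι.isSmoothEmbedding.contMDiff = π) ∧
    (∀ (d₁ d₂ : ℕ)
      (M₁ : Type u) [TopologicalSpace M₁] [T2Space M₁] [ParacompactSpace M₁]
      [ChartedSpace (HolNbhd.Cn d₁) M₁] [IsManifold 𝓘(ℂ, HolNbhd.Cn d₁) ω M₁]
      (M₂ : Type u) [TopologicalSpace M₂] [T2Space M₂] [ParacompactSpace M₂]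
      [ChartedSpace (HolNbhd.Cn d₂) M₂] [IsManifold 𝓘(ℂ, HolNbhd.Cn d₂) ω M₂]
      (ι₁ : M → M₁) (ι₂ : M → M₂)
      (h₁ : HolNbhd.IsClosedHolEmbedding 𝓘(ℂ, HolNbhd.Cn m) 𝓘(ℂ, HolNbhd.Cn d₁) ι₁)
      (h₂ : HolNbhd.IsClosedHolEmbedding 𝓘(ℂ, HolNbhd.Cn m) 𝓘(ℂ, HolNbhd.Cn d₂) ι₂)
      (φ : HolNbhd.inverseImage 𝓘(ℂ, HolNbhd.Cn d₁) ι₁ ≅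
        HolNbhd.inverseImage 𝓘(ℂ, HolNbhd.Cn d₂) ι₂),
      φ.hom ≫ HolNbhd.sharp 𝓘(ℂ, HolNbhd.Cn m) 𝓘(ℂ, HolNbhd.Cn d₂) ι₂
          h₂.isSmoothEmbedding.contMDiff =
        HolNbhd.sharp 𝓘(ℂ, HolNbhd.Cn m) 𝓘(ℂ, HolNbhd.Cn d₁) ι₁
          h₁.isSmoothEmbedding.contMDiff →
      (∃ Φ : HolNbhd.NbhdBiholomorphism 𝓘(ℂ, HolNbhd.Cn d₁) 𝓘(ℂ, HolNbhd.Cn d₂) ι₁ ι₂,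
        Φ.Induces φ.hom) ∧
      (∀ Φ Ψ : HolNbhd.NbhdBiholomorphism 𝓘(ℂ, HolNbhd.Cn d₁) 𝓘(ℂ, HolNbhd.Cn d₂) ι₁ ι₂,
        Φ.Induces φ.hom → Ψ.Induces φ.hom → Φ.SameGerm Ψ)) := by
  refine ⟨fun n A π h => h.exists_neighbourhood, ?_⟩
  intro d₁ d₂ M₁ _ _ _ _ _ M₂ _ _ _ _ _ ι₁ ι₂ h₁ h₂ φ hφ
  have e₁ := h₁.isSmoothEmbedding.isEmbedding
  have e₂ := h₂.isSmoothEmbedding.isEmbedding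
  refine ⟨HolNbhd.exists_induces e₁ e₂ h₁.isClosed_range h₂.isClosed_range ?_,
    fun Φ Ψ hΦ hΨ => hΦ.sameGerm hΨ e₁.continuous e₂.continuous⟩
  -- Compatibility of φ with the two morphisms to the structure sheaf is exactly equality of values.
  intro V _ _ s x
  have := ConcreteCategory.congr_hom (congrArg (fun f => f.hom.app (op V)) hφ) s
  exact (congrFun (congrArg Subtype.val this) x).symm
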